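/- **Setting.** A GPT $(V,C,u)$ is a real vector space $V$ of finite dimension $d$ with a closed, convex, salient, generating cone $C$ and a functional $u\in\mathrm{int}(C^*)$. Its base norm is $\|x\|=\max\{f(x): -u\le f\le u\}$, where $f\le g$ means $g-f\in C^*$. A measurement is a finite family $(e_i)$ in $[0,u]$ with $\sum_i e_i=u$; a set $\mathcal M$ of measurements has the distinguishability norm $\|x\|_{\mathcal M}=\sup_{(e_i)\in\mathcal M}\sum_i|e_i(x)|$ and the error probability $P_e^{\mathcal M}(\rho,\sigma;p)=\frac12(1-\|p\rho-(1-p)\sigma\|_{\mathcal M})$. Let $V_0=\ker u$. Let $(V,C,u)$ be completely symmetric: a compact group $G$ has a continuous representation $\zeta$ on $V$ that maps normalised states ($\omega\in C$, $u(\omega)=1$) to normalised states and is irreducible and nontrivial on $V_0$. Let $C_{AB}\subset V\otimes V$ be the cone of a GPT with unit $U=u\otimes u$, with $C\otimes_{\min}C\subseteq C_{AB}\subseteq C\otimes_{\max}C$, where $C\otimes_{\min}C$ is the convex hull of $\{a\otimes b: a,b\in C\}$ and $C\otimes_{\max}C$ is the dual cone of $C^*\otimes_{\min}C^*$. Assume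 that $C_{AB}$ respects the symmetry: $(\zeta_g\otimes\zeta_g)(C_{AB})\subseteq C_{AB}$ for all $g\in G$, and, moreover, either $V_0$ is of real type (only the scalars commute with the action of $G$ on $V_0$) or $C_{AB}$ is invariant under the exchange of the two factors. $\mathrm{SEP}$ is the set of measurements on the composite with all effects in $C^*\otimes_{\min}C^*$. A Werner state is a state $\omega\in C_{AB}$ with $U(\omega)=1$ that is exchange-symmetric (which is automatic if $V_0$ is of real type) and that is, as a map $V^*\to V$, an isomorphism of $G$-representations. Let $u_*\in V$ be $G$-invariant with $u(u_*)=1$, let $U_*=u_*\otimes u_*$, $V_0^*=\{f\in V^*: f(u_*)=0\}$, let $\mathcal E\in V_0\otimes V_0$ be a symmetric $G$-invariant tensor such that $\langle f,g\rangle_{\mathcal E}=(f\otimes g)(\mathcal E)$ is positive definite on $V_0^*$, and let $\mathcal E_*\in V_0^*\otimes V_0^*$ be its inverse, with $\langle v,w\rangle_{\mathcal E_*}=\mathcal E_*(v\otimes w)$ on $V_0$. Put $\chi_\varphi=U_*+\varphi\,\mathcal E$ and $$k_\pm=\max\{k:\chi_{\pm k}\in C_{AB}\},\qquad k^*_\pm=\max\{k: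 U\pm k\,\mathcal E_*\in C_{AB}^*\},$$ $$m_+=\max\{\langle v,v\rangle_{\mathcal E_*}: v\in V_0,\ u_*+v\in C\},\quad m_-=\max\{\langle v,w\rangle_{\mathcal E_*}: v,w\in V_0,\ u_*+v,\,u_*-w\in C\},$$ $$m_+^*=\max\{\langle f,f\rangle_{\mathcal E}: f\in V_0^*,\ u+f\in C^*\},\quad m_-^*=\max\{\langle f,g\rangle_{\mathcal E}: f,g\in V_0^*,\ u+f,\,u-g\in C^*\}.$$ **Theorem.** Such $u_*,\mathcal E,\mathcal E_*$ exist. For every choice of them all the maxima above are attained, $k_\pm>0$, $m^*_\pm>0$, and: 1. $k_\pm\ge \frac{m_\pm}{d-1}$, and $\chi_\varphi$ is separable (lies in $C\otimes_{\min}C$) if and only if $-\frac{m_-}{d-1}\le\varphi\le\frac{m_+}{d-1}$. 2. $m_-\le m_+$, $m_-^*\le m_+^*$, $k_\pm^*k_\mp=\frac1{d-1}$ and $1\le m_\pm m_\mp^*\le d-1$. 3. The highest efficiency of data hiding against $\mathrm{SEP}$ with only Werner states, that is, the largest $R\ge1$ such that $P_e^{\mathbf M}(\rho,\sigma;p)=0$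 and $P_e^{\mathrm{SEP}}(\rho,\sigma;p)=\frac12(1-\frac1R)$ for some Werner states $\rho,\sigma$ and some $p\in[0,1]$ (with $\mathbf M$ the set of all measurements), is attained and equals $$\max_{0\ne(a,b)\in\mathbb R^2}\frac{\|aU_*+b\,\mathcal E\|}{\|aU_*+b\,\mathcal E\|_{\mathrm{SEP}}}=1+\frac{2}{k_++k_-}\max\Big\{\frac1{m_+^*}-k_-,\ \frac1{m_-^*}-k_+\Big\}.$$ -/

import Mathlib

open TensorProduct Module

noncomputable section

/-- A general probabilistic theory `(V, C, u)`: a closed, convex, salient and generating cone `C`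
in a real finite-dimensional space, and a functional `u` in the interior of the dual cone.
The module topology is the canonical topology of a finite-dimensional real vector space. -/
structure GPT (V : Type*) [AddCommGroup V] [Module ℝ V] where
  cone : PointedCone ℝ V
  unit : Dual ℝ V
  closed : @IsClosed V (moduleTopology ℝ V) cone
  salient : ∀ x ∈ cone, -x ∈ cone → x = 0
  generating : Submodule.span ℝ (cone : Set V) = ⊤
  unit_interior : unit ∈ @interior (Dual ℝ V) (moduleTopology ℝ (Dual ℝ V))
    (PointedCone.dual (Dual.eval ℝ V) (cone : Set V))

namespace GPT

variable {V : Type*} [AddCommGroup V] [Module ℝ V]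

/-- The dual cone `C*`. -/
def dualCone (A : GPT V) : PointedCone ℝ (Dual ℝ V) :=
  PointedCone.dual (Dual.eval ℝ V) (A.cone : Set V)

/-- The effects `[0, u]`. -/
def effects (A : GPT V) : Set (Dual ℝ V) :=
  {e | e ∈ A.dualCone ∧ A.unit - e ∈ A.dualCone}

/-- The base norm `‖x‖ = max {f x : -u ≤ f ≤ u}`. -/
def baseNorm (A : GPT V) (x : V) : ℝ :=
  sSup {r : ℝ | ∃ f : Dual ℝ V, A.unit + f ∈ A.dualCone ∧ A.unit - f ∈ A.dualCone ∧ r = f x}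

/-- A measurement: a finite family of effects that sums up to `u`. -/
structure Measurement (A : GPT V) where
  outcomes : ℕ
  effect : Fin outcomes → Dual ℝ V
  mem_effects : ∀ i, effect i ∈ A.effects
  sum_effect : ∑ i, effect i = A.unit

/-- The distinguishability norm of a set of measurements. -/
def distNorm (A : GPT V) (M : Set A.Measurement) (x : V) : ℝ :=
  sSup {r : ℝ | ∃ μ ∈ M, r = ∑ i, |μ.effect i x|}

/-- The lowest probability of error for discriminating `ρ` and `σ`, of a priori probabilities
`p` and `1 - p`, by measurements in `M`. -/
def errorProb (A : GPT V) (M : Set A.Measurement) (ρ σ : V) (p : ℝ) : ℝ :=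
  (1 / 2) * (1 - A.distNorm M (p • ρ - (1 - p) • σ))

end GPT

variable {V : Type*} [AddCommGroup V] [Module ℝ V]

/-- The functional `f ⊗ g` on `V ⊗ V`. -/
def prodFunctional (f g : Dual ℝ V) : Dual ℝ (V ⊗[ℝ] V) :=
  dualDistrib ℝ V V (f ⊗ₜ[ℝ] g)

/-- A tensor in `V ⊗ V` as a linear map `V* → V`, namely `f ↦ (f ⊗ id) X`. -/
def tensorMap (X : V ⊗[ℝ] V) (f : Dual ℝ V) : V :=
  TensorProduct.lid ℝ V (LinearMap.rTensor V f X)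

/-- `AB` is a composite of two copies of `A`: it lives on `V ⊗ V`, its unit is `u ⊗ u` and its cone
lies between the minimal and the maximal tensor product. -/
structure IsComposite (A : GPT V) (AB : GPT (V ⊗[ℝ] V)) : Prop where
  unit_eq : AB.unit = prodFunctional A.unit A.unit
  min_le : PointedCone.minTensorProduct A.cone A.cone ≤ AB.cone
  le_max : AB.cone ≤ PointedCone.maxTensorProduct A.cone A.cone

/-- The separable measurements: all effects lie in the minimal tensor product of `C*` with `C*`. -/
def SEP (A : GPT V) (AB : GPT (V ⊗[ℝ] V)) : Set AB.Measurement :=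
  {μ | ∀ i, μ.effect i ∈
    ((PointedCone.minTensorProduct A.dualCone A.dualCone).map (dualDistrib ℝ V V) :
      PointedCone ℝ (Dual ℝ (V ⊗[ℝ] V)))}

section Symmetry

variable {G : Type*} [Group G]

/-- The representation `ζ` of the topological group `G` makes `A` completely symmetric: it is
continuous (all matrix coefficients are), maps normalised states to normalised states, and is
irreducible and nontrivial on `V₀ = {x | u x = 0}`. Compactness of `G` is required separately. -/
structure IsCompletelySymmetric [TopologicalSpace G] (A : GPT V) (ζ : Representation ℝ G V) :
    Prop where
  continuous : ∀ (f : Dual ℝ V) (x : V), Continuous fun g => f (ζ g x)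
  maps_states : ∀ g, ∀ ω ∈ A.cone, A.unit ω = 1 → ζ g ω ∈ A.cone ∧ A.unit (ζ g ω) = 1
  irreducible : ∀ W : Submodule ℝ V, W ≤ LinearMap.ker A.unit →
    (∀ g, ∀ x ∈ W, ζ g x ∈ W) → W = ⊥ ∨ W = LinearMap.ker A.unit
  nontrivial : ∃ g, ∃ x ∈ LinearMap.ker A.unit, ζ g x ≠ x

/-- `V₀` is of real type: every linear map that commutes with the representation acts on `V₀` as
a scalar. -/
def IsRealType (A : GPT V) (ζ : Representation ℝ G V) : Prop :=
  ∀ T : V →ₗ[ℝ] V, (∀ g x, T (ζ g x) = ζ g (T x)) →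
    ∃ c : ℝ, ∀ x ∈ LinearMap.ker A.unit, T x = c • x

/-- The cone is invariant under all `ζ_g ⊗ ζ_g`. -/
def IsSymmetricCone (AB : GPT (V ⊗[ℝ] V)) (ζ : Representation ℝ G V) : Prop :=
  ∀ g, ∀ x ∈ AB.cone, TensorProduct.map (ζ g) (ζ g) x ∈ AB.cone

/-- The cone is invariant under the exchange of the two copies. -/
def IsFlipInvariantCone (AB : GPT (V ⊗[ℝ] V)) : Prop :=
  ∀ x ∈ AB.cone, TensorProduct.comm ℝ V V x ∈ AB.cone

/-- `uS` is the invariant vector `u_*` with `u u_* = 1`; the invariant tensor `E ∈ V₀ ⊗ V₀` is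
a scalar product on `V₀* = {f | f u_* = 0}`, and the functional `Es` on `V ⊗ V` is its inverse
`E_* ∈ V₀* ⊗ V₀*`, that is, the dual scalar product on `V₀`, extended by zero on `u_*`. -/
structure IsWernerFrame (A : GPT V) (ζ : Representation ℝ G V) (uS : V) (E : V ⊗[ℝ] V)
    (Es : Dual ℝ (V ⊗[ℝ] V)) : Prop where
  invariant_uS : ∀ g, ζ g uS = uS
  unit_uS : A.unit uS = 1
  mem_E : E ∈ LinearMap.range (TensorProduct.map (LinearMap.ker A.unit).subtype
    (LinearMap.ker A.unit).subtype)
  invariant_E : ∀ g, TensorProduct.map (ζ g) (ζ g) E = E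
  symm_E : TensorProduct.comm ℝ V V E = E
  pos_E : ∀ f : Dual ℝ V, f uS = 0 → f ≠ 0 → 0 < prodFunctional f f E
  Es_left : ∀ v, Es (uS ⊗ₜ[ℝ] v) = 0
  Es_right : ∀ v, Es (v ⊗ₜ[ℝ] uS) = 0
  Es_inverse : ∀ f : Dual ℝ V, f uS = 0 → ∀ v ∈ LinearMap.ker A.unit,
    Es (tensorMap E f ⊗ₜ[ℝ] v) = f v

/-- A Werner state: a normalised state of the composite that is exchange-symmetric and, as a map
`V* → V`, an isomorphism of representations (`V*` carries the dual representation
`f ↦ f ∘ ζ_{g⁻¹}`). If `V₀` is of real type the exchange symmetry is automatic. -/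
structure IsWernerState (AB : GPT (V ⊗[ℝ] V)) (ζ : Representation ℝ G V) (ω : V ⊗[ℝ] V) :
    Prop where
  mem_cone : ω ∈ AB.cone
  normalised : AB.unit ω = 1
  symm : TensorProduct.comm ℝ V V ω = ω
  bijective : Function.Bijective (tensorMap ω)
  equivariant : ∀ g f, tensorMap ω (f ∘ₗ ζ g⁻¹) = ζ g (tensorMap ω f)

/-- The efficiencies `R ≥ 1` of data hiding against separable measurements that are achieved by
a pair of Werner states. -/
def wernerEfficiencies (A : GPT V) (AB : GPT (V ⊗[ℝ] V)) (ζ : Representation ℝ G V) : Set ℝ :=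
  {R | 1 ≤ R ∧ ∃ ρ σ : V ⊗[ℝ] V, IsWernerState AB ζ ρ ∧ IsWernerState AB ζ σ ∧
    ∃ p ∈ Set.Icc (0 : ℝ) 1, AB.errorProb Set.univ ρ σ p = 0 ∧
      AB.errorProb (SEP A AB) ρ σ p = (1 / 2) * (1 - 1 / R)}

end Symmetry

/-- The tensor `χ_φ = U_* + φ E`, where `U_* = u_* ⊗ u_*`. -/
def wernerTensor (uS : V) (E : V ⊗[ℝ] V) (φ : ℝ) : V ⊗[ℝ] V :=
  uS ⊗ₜ[ℝ] uS + φ • E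

/-- The set whose maximum is `k_+` (for `s = 1`) or `k_-` (for `s = -1`). -/
def kSet (AB : GPT (V ⊗[ℝ] V)) (uS : V) (E : V ⊗[ℝ] V) (s : ℝ) : Set ℝ :=
  {k | wernerTensor uS E (s * k) ∈ AB.cone}

/-- The set whose maximum is `k_+^*` (for `s = 1`) or `k_-^*` (for `s = -1`). -/
def kStarSet (AB : GPT (V ⊗[ℝ] V)) (Es : Dual ℝ (V ⊗[ℝ] V)) (s : ℝ) : Set ℝ :=
  {k | AB.unit + (s * k) • Es ∈ AB.dualCone}

/-- The set whose maximum is `m_+`. -/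
def mPlusSet (A : GPT V) (uS : V) (Es : Dual ℝ (V ⊗[ℝ] V)) : Set ℝ :=
  {r | ∃ v ∈ LinearMap.ker A.unit, uS + v ∈ A.cone ∧ r = Es (v ⊗ₜ[ℝ] v)}

/-- The set whose maximum is `m_-`. -/
def mMinusSet (A : GPT V) (uS : V) (Es : Dual ℝ (V ⊗[ℝ] V)) : Set ℝ :=
  {r | ∃ v ∈ LinearMap.ker A.unit, ∃ w ∈ LinearMap.ker A.unit,
    uS + v ∈ A.cone ∧ uS - w ∈ A.cone ∧ r = Es (v ⊗ₜ[ℝ] w)}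

/-- The set whose maximum is `m_+^*`. -/
def mStarPlusSet (A : GPT V) (uS : V) (E : V ⊗[ℝ] V) : Set ℝ :=
  {r | ∃ f : Dual ℝ V, f uS = 0 ∧ A.unit + f ∈ A.dualCone ∧ r = prodFunctional f f E}

/-- The set whose maximum is `m_-^*`. -/
def mStarMinusSet (A : GPT V) (uS : V) (E : V ⊗[ℝ] V) : Set ℝ :=
  {r | ∃ f g : Dual ℝ V, f uS = 0 ∧ g uS = 0 ∧
    A.unit + f ∈ A.dualCone ∧ A.unit - g ∈ A.dualCone ∧ r = prodFunctional f g E}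

/-- The ratios `‖a U_* + b E‖ / ‖a U_* + b E‖_SEP` for `(a, b) ≠ (0, 0)`. -/
def wernerRatios (A : GPT V) (AB : GPT (V ⊗[ℝ] V)) (uS : V) (E : V ⊗[ℝ] V) : Set ℝ :=
  {r | ∃ a b : ℝ, (a, b) ≠ (0, 0) ∧
    r = AB.baseNorm (a • (uS ⊗ₜ[ℝ] uS) + b • E) /
      AB.distNorm (SEP A AB) (a • (uS ⊗ₜ[ℝ] uS) + b • E)}

end

/-! ### Finite-dimensional topology -/

section FiniteDimensional

/-- A norm on a finite-dimensional real vector space. -/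
@[reducible] noncomputable def coordNorm (W : Type*) [AddCommGroup W] [Module ℝ W]
    [FiniteDimensional ℝ W] : NormedAddCommGroup W :=
  NormedAddCommGroup.induced W (Fin (finrank ℝ W) → ℝ) (finBasis ℝ W).equivFun
    (finBasis ℝ W).equivFun.injective

/-- The space is a normed space for `coordNorm`. -/
@[reducible] noncomputable def coordNormedSpace (W : Type*) [AddCommGroup W] [Module ℝ W]
    [FiniteDimensional ℝ W] :
    letI := coordNorm W
    NormedSpace ℝ W :=
  letI := coordNorm W
  NormedSpace.induced ℝ W (Fin (finrank ℝ W) → ℝ) (finBasis ℝ W).equivFun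

/-- The bridge between the canonical topology used for cones and theorems about normed spaces. -/
theorem coordNorm_topology (W : Type*) [AddCommGroup W] [Module ℝ W] [FiniteDimensional ℝ W] :
    (coordNorm W).toMetricSpace.toPseudoMetricSpace.toUniformSpace.toTopologicalSpace =
      moduleTopology ℝ W := by
  let := coordNorm W
  let := coordNormedSpace W
  have : IsModuleTopology ℝ W := isModuleTopologyOfFiniteDimensional
  exact eq_moduleTopology ℝ W

variable {W : Type*} [AddCommGroup W] [Module ℝ W] [FiniteDimensional ℝ W]
variable {W₂ : Type*} [AddCommGroup W₂] [Module ℝ W₂] [FiniteDimensional ℝ W₂]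

theorem exists_separating_dual {D : Set W} (hconv : Convex ℝ D)
    (hcl : @IsClosed W (moduleTopology ℝ W) D) {x : W} (hx : x ∉ D) :
    ∃ (f : Dual ℝ W) (c : ℝ), (∀ y ∈ D, f y < c) ∧ c < f x := by
  let := coordNorm W
  let := coordNormedSpace W
  rw [← coordNorm_topology W] at hcl
  obtain ⟨f, c, h1, h2⟩ := geometric_hahn_banach_closed_point hconv hcl hx
  exact ⟨f.toLinearMap, c, h1, h2⟩

/-- By compactness `ℓ` has a positive lower bound ε on the unit vectors of `D`; by homogeneity the
slice lies in the ball of radius 1/ε. -/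
theorem isCompact_slice {D : Set W} (hcl : @IsClosed W (moduleTopology ℝ W) D)
    (hcone : ∀ c : ℝ, 0 ≤ c → ∀ x ∈ D, c • x ∈ D) {ℓ : Dual ℝ W}
    (hpos : ∀ x ∈ D, x ≠ 0 → 0 < ℓ x) :
    @IsCompact W (moduleTopology ℝ W) {x | x ∈ D ∧ ℓ x = 1} := by
  let := coordNorm W
  let := coordNormedSpace W
  rw [← coordNorm_topology W] at hcl ⊢
  have : ProperSpace W := FiniteDimensional.proper ℝ W
  have hℓ : Continuous ℓ := ℓ.continuous_of_finiteDimensional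
  have hK : IsCompact (D ∩ Metric.sphere (0 : W) 1) :=
    (isCompact_sphere (0 : W) 1).inter_left hcl
  obtain ⟨ε, hε, hmin⟩ : ∃ ε : ℝ, 0 < ε ∧ ∀ x ∈ D ∩ Metric.sphere (0 : W) 1, ε ≤ ℓ x := by
    rcases (D ∩ Metric.sphere (0 : W) 1).eq_empty_or_nonempty with he | hne
    · exact ⟨1, one_pos, by simp [he]⟩
    · obtain ⟨x, hx, hxm⟩ := hK.exists_isMinOn hne hℓ.continuousOn
      refine ⟨ℓ x, hpos x hx.1 ?_, fun y hy => hxm hy⟩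
      rintro rfl
      simpa using hx.2
  refine Metric.isCompact_of_isClosed_isBounded
    (hcl.inter (isClosed_eq hℓ continuous_const)) ?_
  refine (Metric.isBounded_closedBall (x := (0 : W)) (r := 1 / ε)).subset ?_
  rintro x ⟨hx, hx1⟩
  rw [mem_closedBall_zero_iff]
  have hx0 : x ≠ 0 := by rintro rfl; simp at hx1
  have hn : 0 < ‖x‖ := norm_pos_iff.2 hx0
  have := hmin (‖x‖⁻¹ • x) ⟨hcone _ (by positivity) x hx, by
    simp [norm_smul, hn.ne']⟩
  rw [map_smul, hx1, smul_eq_mul, mul_one] at this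
  rw [le_div_iff₀ hε]
  calc ‖x‖ * ε ≤ ‖x‖ * ‖x‖⁻¹ := by gcongr
    _ = 1 := mul_inv_cancel₀ hn.ne'

theorem sum_eq_sum_comp_embedding {ι κ M : Type*} [Fintype ι] [Fintype κ] [AddCommMonoid M]
    (e : ι ↪ κ) (F : κ → M) (hF : ∀ j ∉ Set.range e, F j = 0) : ∑ j, F j = ∑ i, F (e i) := by
  rw [← Finset.sum_map Finset.univ e F]
  refine (Finset.sum_subset (Finset.subset_univ _) fun j _ hj => hF j ?_).symm
  simpa using hj

/-- Carathéodory: in finite dimension the convex hull of a compact set is compact. -/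
theorem IsCompact.convexHull_of_finiteDimensional {E : Type*} [NormedAddCommGroup E]
    [NormedSpace ℝ E] [FiniteDimensional ℝ E] {s : Set E} (hs : IsCompact s) :
    IsCompact (convexHull ℝ s) := by
  rcases s.eq_empty_or_nonempty with rfl | ⟨s₀, hs₀⟩
  · simp
  -- This many points always suffice, so the hull is a continuous image of the compact set simplex ×
  -- sᴺ.
  let N := finrank ℝ E + 1
  have hK : IsCompact (stdSimplex ℝ (Fin N) ×ˢ Set.pi Set.univ fun _ : Fin N => s) :=
    (isCompact_stdSimplex ℝ (Fin N)).prod (isCompact_univ_pi fun _ => hs)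
  have hcont : Continuous fun p : (Fin N → ℝ) × (Fin N → E) => ∑ i, p.1 i • p.2 i := by fun_prop
  convert hK.image hcont using 1
  apply Set.Subset.antisymm
  · intro x hx
    obtain ⟨ι, _, z, w, hz, hind, hw, hw1, rfl⟩ := eq_pos_convex_span_of_mem_convexHull hx
    have hcard : Fintype.card ι ≤ Fintype.card (Fin N) := by
      simpa [N] using hind.card_le_finrank_succ.trans
        (Nat.succ_le_succ (Submodule.finrank_le _))
    obtain ⟨e⟩ := Function.Embedding.nonempty_of_card_le hcard
    -- Shorter combinations are padded with weight 0 at the point `s₀`.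
    refine ⟨(Function.extend e w 0, Function.extend e z fun _ => s₀), ⟨⟨fun j => ?_, ?_⟩, ?_⟩, ?_⟩
    · by_cases hj : ∃ i, e i = j
      · obtain ⟨i, rfl⟩ := hj
        simpa [e.injective.extend_apply] using (hw i).le
      · simp [Function.extend_apply' _ _ _ hj]
    · rw [← hw1]
      refine (sum_eq_sum_comp_embedding e _ fun j hj => Function.extend_apply' w (0 : Fin N → ℝ) j hj).trans ?_
      simp [e.injective.extend_apply]
    · intro j _
      by_cases hj : ∃ i, e i = j
      · obtain ⟨i, rfl⟩ := hj
        simpa [e.injective.extend_apply] using hz ⟨i, rfl⟩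
      · simpa [Function.extend_apply' _ _ _ hj] using hs₀
    · refine (sum_eq_sum_comp_embedding e _ fun j hj => ?_).trans ?_
      · have : Function.extend e w 0 j = 0 := Function.extend_apply' w (0 : Fin N → ℝ) j hj
        simp [this]
      · simp [e.injective.extend_apply]
  · rintro _ ⟨⟨w, z⟩, ⟨hw, hz⟩, rfl⟩
    exact (convex_convexHull ℝ s).sum_mem (fun i _ => hw.1 i) hw.2
      fun i _ => subset_convexHull ℝ s (hz i trivial)

theorem continuous_bilinear_uncurry {E F : Type*} [NormedAddCommGroup E] [NormedSpace ℝ E]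
    [FiniteDimensional ℝ E] [NormedAddCommGroup F] [NormedSpace ℝ F]
    [FiniteDimensional ℝ F] (B : E →ₗ[ℝ] E →ₗ[ℝ] F) :
    Continuous fun p : E × E => B p.1 p.2 := by
  have : IsModuleTopology ℝ E := isModuleTopologyOfFiniteDimensional
  have : IsModuleTopology ℝ F := isModuleTopologyOfFiniteDimensional
  exact IsModuleTopology.continuous_bilinear_of_finite_left B

theorem isClosed_convexHull_image2 {S : Set W} (hS : @IsCompact W (moduleTopology ℝ W) S)
    (B : W →ₗ[ℝ] W →ₗ[ℝ] W₂) :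
    @IsClosed W₂ (moduleTopology ℝ W₂) (convexHull ℝ (Set.image2 (fun a b => B a b) S S)) := by
  let := coordNorm W
  let := coordNormedSpace W
  let := coordNorm W₂
  let := coordNormedSpace W₂
  rw [← coordNorm_topology] at hS ⊢
  have := (hS.prod hS).image (continuous_bilinear_uncurry B)
  rw [Set.image_prod fun a b => B a b] at this
  exact this.convexHull_of_finiteDimensional.isClosed

theorem exists_isGreatest_diagonal {S : Set W} (hS : @IsCompact W (moduleTopology ℝ W) S)
    (hne : S.Nonempty) (B : W →ₗ[ℝ] W →ₗ[ℝ] ℝ) :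
    ∃ m, IsGreatest {r | ∃ x ∈ S, r = B x x} m := by
  let := coordNorm W
  let := coordNormedSpace W
  rw [← coordNorm_topology] at hS
  have hc : Continuous fun x => B x x :=
    (continuous_bilinear_uncurry B).comp (continuous_id.prodMk continuous_id)
  obtain ⟨m, hm⟩ := (hS.image hc).exists_isGreatest (hne.image _)
  have : {r | ∃ x ∈ S, r = B x x} = (fun x => B x x) '' S := by
    ext r
    simp [eq_comm]
  exact ⟨m, this ▸ hm⟩

theorem exists_isGreatest_bilinear {S : Set W} (hS : @IsCompact W (moduleTopology ℝ W) S)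
    (hne : S.Nonempty) (B : W →ₗ[ℝ] W →ₗ[ℝ] ℝ) :
    ∃ m, IsGreatest {r | ∃ x ∈ S, ∃ y ∈ S, r = B x y} m := by
  let := coordNorm W
  let := coordNormedSpace W
  rw [← coordNorm_topology] at hS
  obtain ⟨m, hm⟩ := ((hS.prod hS).image (continuous_bilinear_uncurry B)).exists_isGreatest
    ((hne.prod hne).image _)
  have : {r | ∃ x ∈ S, ∃ y ∈ S, r = B x y} = (fun p : W × W => B p.1 p.2) '' S ×ˢ S := by
    ext r
    constructor
    · rintro ⟨x, hx, y, hy, rfl⟩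
      exact ⟨(x, y), ⟨hx, hy⟩, rfl⟩
    · rintro ⟨⟨x, y⟩, ⟨hx, hy⟩, rfl⟩
      exact ⟨x, hx, y, hy, rfl⟩
  exact ⟨m, this ▸ hm⟩

/-- A line meets a compact set in a closed bounded set of parameters. -/
theorem exists_isGreatest_line {S : Set W} (hS : @IsCompact W (moduleTopology ℝ W) S)
    {a b : W} (hb : b ≠ 0) (hne : ∃ k : ℝ, a + k • b ∈ S) :
    ∃ m, IsGreatest {k : ℝ | a + k • b ∈ S} m := by
  let := coordNorm W
  let := coordNormedSpace W
  rw [← coordNorm_topology] at hS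
  have hcl : IsClosed {k : ℝ | a + k • b ∈ S} :=
    hS.isClosed.preimage (f := fun k : ℝ => a + k • b) (by fun_prop)
  obtain ⟨F, hF⟩ : ∃ F : Dual ℝ W, F b = 1 :=
    Projective.exists_dual_eq_one ℝ hb
  have hbd : BddAbove {k : ℝ | a + k • b ∈ S} := by
    obtain ⟨c, hc⟩ := (hS.image F.continuous_of_finiteDimensional).bddAbove
    refine ⟨c - F a, fun k hk => ?_⟩
    have := hc ⟨_, hk, rfl⟩
    simp only [map_add, map_smul, hF, smul_eq_mul, mul_one] at this
    linarith
  exact ⟨_, hcl.csSup_mem hne hbd, fun k hk => le_csSup hbd hk⟩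

/-- The dual cone is closed. -/
theorem isClosed_dualCone_eval (C : Set W) :
    @IsClosed (Dual ℝ W) (moduleTopology ℝ (Dual ℝ W))
      (PointedCone.dual (Dual.eval ℝ W) C : Set (Dual ℝ W)) := by
  let := coordNorm (Dual ℝ W)
  let := coordNormedSpace (Dual ℝ W)
  rw [← coordNorm_topology]
  have : (PointedCone.dual (Dual.eval ℝ W) C : Set (Dual ℝ W)) =
      ⋂ x ∈ C, {f | 0 ≤ Dual.eval ℝ W x f} := by
    ext f
    simp
  rw [this]
  exact isClosed_biInter fun x _ =>
    isClosed_le continuous_const (LinearMap.continuous_of_finiteDimensional (Dual.eval ℝ W x))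

/-- A functional in the interior of the dual cone is strictly positive. -/
theorem pos_of_mem_interior_dual {C : Set W} {ℓ : Dual ℝ W}
    (hℓ : ℓ ∈ @interior (Dual ℝ W) (moduleTopology ℝ (Dual ℝ W))
      (PointedCone.dual (Dual.eval ℝ W) C)) {x : W} (hx : x ∈ C) (hx0 : x ≠ 0) : 0 < ℓ x := by
  let := coordNorm (Dual ℝ W)
  let := coordNormedSpace (Dual ℝ W)
  rw [← coordNorm_topology] at hℓ
  obtain ⟨F, hF⟩ : ∃ F : Dual ℝ W, F x = 1 :=
    Projective.exists_dual_eq_one ℝ hx0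
  have hc : Filter.Tendsto (fun t : ℝ => ℓ - t • F) (nhdsWithin 0 (Set.Ioi 0)) (nhds ℓ) := by
    have : Continuous (fun t : ℝ => ℓ - t • F) := by fun_prop
    simpa using (this.tendsto 0).mono_left nhdsWithin_le_nhds
  -- An interior functional stays in the dual cone after subtracting a small `t • F`, and `F x = 1`
  -- turns this into `ℓ x ≥ t > 0`.
  obtain ⟨t, ht, ht0⟩ := ((hc.eventually (mem_interior_iff_mem_nhds.1 hℓ)).and
    self_mem_nhdsWithin).exists
  have h1 : 0 ≤ (ℓ - t • F) x := ht hx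
  simp only [LinearMap.sub_apply, LinearMap.smul_apply, hF, smul_eq_mul, mul_one] at h1
  exact lt_of_lt_of_le ht0 (by linarith)

end FiniteDimensional

/-! ### The invariant mean of a compact group -/

section Mean

/-- Integration against normalised Haar measure. Strict positivity is stated at the identity because
that is where the integrands below are known. -/
theorem exists_invariant_mean (G : Type*) [Group G] [TopologicalSpace G] [IsTopologicalGroup G]
    [CompactSpace G] : ∃ I : C(G, ℝ) →ₗ[ℝ] ℝ, I 1 = 1 ∧ (∀ φ, 0 ≤ φ → 0 ≤ I φ) ∧
      (∀ φ, 0 ≤ φ → 0 < φ 1 → 0 < I φ) ∧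
      ∀ h φ, I (φ.comp (ContinuousMap.mulLeft h)) = I φ := by
  let : MeasurableSpace G := borel G
  have : BorelSpace G := ⟨rfl⟩
  let K : TopologicalSpace.PositiveCompacts G := ⊤
  let μ := MeasureTheory.Measure.haarMeasure K
  have hμ : μ Set.univ = 1 := by
    simpa [K] using MeasureTheory.Measure.haarMeasure_self (K₀ := K)
  have : MeasureTheory.IsProbabilityMeasure μ := ⟨hμ⟩
  have hint : ∀ φ : C(G, ℝ), MeasureTheory.Integrable φ μ := fun φ =>
    φ.continuous.integrable_of_hasCompactSupport (HasCompactSupport.of_compactSpace _)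
  refine ⟨{ toFun := fun φ => ∫ g, φ g ∂μ, map_add' := fun φ ψ => ?_, map_smul' := fun c φ => ?_ },
    ?_, fun φ hφ => ?_, fun φ hφ hφ1 => ?_, fun h φ => ?_⟩
  · exact MeasureTheory.integral_add (hint φ) (hint ψ)
  · exact MeasureTheory.integral_const_mul c _
  · simp
  · exact MeasureTheory.integral_nonneg hφ
  · exact φ.continuous.integral_pos_of_hasCompactSupport_nonneg_nonzero
      (HasCompactSupport.of_compactSpace _) hφ hφ1.ne'
  · exact MeasureTheory.integral_mul_left_eq_self (μ := μ) φ h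

end Mean

/-! ### Averages over a compact group -/

section Average

/-- The invariant mean of a compact group. -/
noncomputable def invariantMean (G : Type*) [Group G] [TopologicalSpace G] [IsTopologicalGroup G]
    [CompactSpace G] : C(G, ℝ) →ₗ[ℝ] ℝ :=
  (exists_invariant_mean G).choose

variable {G : Type*} [Group G] [TopologicalSpace G] [IsTopologicalGroup G] [CompactSpace G]

theorem invariantMean_one : invariantMean G 1 = 1 :=
  (exists_invariant_mean G).choose_spec.1

theorem invariantMean_nonneg {φ : C(G, ℝ)} (hφ : 0 ≤ φ) : 0 ≤ invariantMean G φ :=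
  (exists_invariant_mean G).choose_spec.2.1 φ hφ

theorem invariantMean_pos {φ : C(G, ℝ)} (hφ : 0 ≤ φ) (h1 : 0 < φ 1) : 0 < invariantMean G φ :=
  (exists_invariant_mean G).choose_spec.2.2.1 φ hφ h1

theorem invariantMean_mulLeft (h : G) (φ : C(G, ℝ)) :
    invariantMean G (φ.comp (ContinuousMap.mulLeft h)) = invariantMean G φ :=
  (exists_invariant_mean G).choose_spec.2.2.2 h φ

theorem invariantMean_const (c : ℝ) : invariantMean G (ContinuousMap.const G c) = c := by
  have : ContinuousMap.const G c = c • (1 : C(G, ℝ)) := by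
    ext
    simp
  rw [this, map_smul, invariantMean_one, smul_eq_mul, mul_one]

theorem invariantMean_le {φ : C(G, ℝ)} {c : ℝ} (hφ : ∀ g, φ g ≤ c) : invariantMean G φ ≤ c := by
  have h := invariantMean_nonneg (φ := ContinuousMap.const G c - φ)
    (fun g => by simpa using hφ g)
  rw [map_sub, invariantMean_const] at h
  linarith

variable {W : Type*} [AddCommGroup W] [Module ℝ W] [FiniteDimensional ℝ W]
variable {W₂ : Type*} [AddCommGroup W₂] [Module ℝ W₂] [FiniteDimensional ℝ W₂]

/-- The average is defined weakly, as an element of the bidual, which is the space itself in finite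
dimension. -/
theorem exists_average (x : G → W) (hx : ∀ f : Dual ℝ W, Continuous fun g => f (x g)) :
    ∃ y : W, ∀ f : Dual ℝ W, f y = invariantMean G ⟨fun g => f (x g), hx f⟩ := by
  let Φ : Dual ℝ (Dual ℝ W) :=
    { toFun := fun f => invariantMean G ⟨fun g => f (x g), hx f⟩
      map_add' := fun f₁ f₂ => by rw [← map_add]; rfl
      map_smul' := fun c f => by rw [← map_smul]; rfl }
  refine ⟨(evalEquiv ℝ W).symm Φ, fun f => ?_⟩
  rw [apply_evalEquiv_symm_apply]
  rfl

/-- The average of a family of vectors over a compact group. -/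
noncomputable def average (x : G → W) (hx : ∀ f : Dual ℝ W, Continuous fun g => f (x g)) : W :=
  (exists_average x hx).choose

variable {x : G → W} {hx : ∀ f : Dual ℝ W, Continuous fun g => f (x g)}

theorem apply_average (f : Dual ℝ W) :
    f (average x hx) = invariantMean G ⟨fun g => f (x g), hx f⟩ :=
  (exists_average x hx).choose_spec f

theorem apply_average_const {f : Dual ℝ W} {c : ℝ} (h : ∀ g, f (x g) = c) :
    f (average x hx) = c := by
  rw [apply_average, ← invariantMean_const (G := G) c]
  congr 1
  ext g
  exact h g

theorem eq_average {y : W}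
    (h : ∀ f : Dual ℝ W, f y = invariantMean G ⟨fun g => f (x g), hx f⟩) : y = average x hx := by
  rw [← sub_eq_zero, ← forall_dual_apply_eq_zero_iff ℝ]
  intro f
  rw [map_sub, apply_average, h, sub_self]

/-- A functional separating the average from `D` would have a mean exceeding a bound on all its
values. -/
theorem average_mem {D : Set W} (hconv : Convex ℝ D)
    (hcl : @IsClosed W (moduleTopology ℝ W) D) (h : ∀ g, x g ∈ D) : average x hx ∈ D := by
  by_contra hn
  obtain ⟨f, c, hf, hc⟩ := exists_separating_dual hconv hcl hn
  rw [apply_average] at hc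
  exact hc.not_ge (invariantMean_le fun g => (hf _ (h g)).le)

theorem average_fixed {L : W →ₗ[ℝ] W} {h : G} (hL : ∀ g, L (x g) = x (h * g)) :
    L (average x hx) = average x hx := by
  refine eq_average fun f => ?_
  have := apply_average (x := x) (hx := hx) (f ∘ₗ L)
  rw [LinearMap.comp_apply] at this
  rw [this, ← invariantMean_mulLeft h ⟨fun g => f (x g), hx f⟩]
  congr 1
  ext g
  simp [hL]

end Average

theorem continuous_apply_map_tensor {G : Type*} [Group G] [TopologicalSpace G] {V : Type*} [AddCommGroup V] [Module ℝ V]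
    [FiniteDimensional ℝ V] {ζ : Representation ℝ G V}
    (hζ : ∀ (f : Dual ℝ V) (x : V), Continuous fun g => f (ζ g x)) (X : V ⊗[ℝ] V)
    (F : Dual ℝ (V ⊗[ℝ] V)) : Continuous fun g => F (TensorProduct.map (ζ g) (ζ g) X) := by
  obtain ⟨F, rfl⟩ := (dualDistribEquiv ℝ V V).surjective F
  change Continuous fun g => dualDistrib ℝ V V F (TensorProduct.map (ζ g) (ζ g) X)
  induction F with
  | zero => simpa using continuous_const
  | add F₁ F₂ h₁ h₂ => simpa using h₁.fun_add h₂
  | tmul f₁ f₂ =>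
    induction X with
    | zero => simpa using continuous_const
    | add X₁ X₂ h₁ h₂ => simpa using h₁.fun_add h₂
    | tmul x y => simpa using (hζ f₁ x).fun_mul (hζ f₂ y)


/-! ### Tensors as bilinear forms -/

section Tensors

variable {V : Type*} [AddCommGroup V] [Module ℝ V]

theorem prodFunctional_tmul (f g : Dual ℝ V) (x y : V) :
    prodFunctional f g (x ⊗ₜ[ℝ] y) = f x * g y := by
  simp [prodFunctional]

theorem prodFunctional_smul_left (c : ℝ) (f g : Dual ℝ V) :
    prodFunctional (c • f) g = c • prodFunctional f g := by
  simp [prodFunctional, ← smul_tmul']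

theorem prodFunctional_smul_right (c : ℝ) (f g : Dual ℝ V) :
    prodFunctional f (c • g) = c • prodFunctional f g := by
  simp [prodFunctional]

theorem tensorMap_tmul (x y : V) (f : Dual ℝ V) : tensorMap (x ⊗ₜ[ℝ] y) f = f x • y := by
  simp [tensorMap]

theorem tensorMap_add_left (X Y : V ⊗[ℝ] V) (f : Dual ℝ V) :
    tensorMap (X + Y) f = tensorMap X f + tensorMap Y f := by
  simp [tensorMap]

theorem tensorMap_smul_left (c : ℝ) (X : V ⊗[ℝ] V) (f : Dual ℝ V) :
    tensorMap (c • X) f = c • tensorMap X f := by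
  simp [tensorMap]

/-- `tensorMap` as a linear map. -/
def tensorHom (X : V ⊗[ℝ] V) : Dual ℝ V →ₗ[ℝ] V where
  toFun := tensorMap X
  map_add' f g := by simp [tensorMap, LinearMap.rTensor_add]
  map_smul' c f := by simp [tensorMap, LinearMap.rTensor_smul]

theorem tensorHom_apply (X : V ⊗[ℝ] V) (f : Dual ℝ V) : tensorHom X f = tensorMap X f := rfl

theorem apply_tensorMap (X : V ⊗[ℝ] V) (f g : Dual ℝ V) :
    g (tensorMap X f) = prodFunctional f g X := by
  induction X with
  | zero => simp [tensorMap]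
  | add X Y hX hY => rw [tensorMap_add_left, map_add, hX, hY, map_add]
  | tmul x y => rw [tensorMap_tmul, prodFunctional_tmul, map_smul, smul_eq_mul]

theorem prodFunctional_comm (f g : Dual ℝ V) (X : V ⊗[ℝ] V) :
    prodFunctional f g (TensorProduct.comm ℝ V V X) = prodFunctional g f X := by
  induction X with
  | zero => simp
  | add X Y hX hY => simp [hX, hY]
  | tmul x y => simp [prodFunctional_tmul, mul_comm]

theorem prodFunctional_map (f g : Dual ℝ V) (L M : V →ₗ[ℝ] V) (X : V ⊗[ℝ] V) :
    prodFunctional f g (TensorProduct.map L M X) = prodFunctional (f ∘ₗ L) (g ∘ₗ M) X := by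
  induction X with
  | zero => simp
  | add X Y hX hY => simp [hX, hY]
  | tmul x y => simp [prodFunctional_tmul]

variable [FiniteDimensional ℝ V]

/-- In finite dimension the product functionals span the dual of V ⊗ V. -/
theorem tensor_ext {X Y : V ⊗[ℝ] V}
    (h : ∀ f g : Dual ℝ V, prodFunctional f g X = prodFunctional f g Y) : X = Y := by
  rw [← sub_eq_zero, ← forall_dual_apply_eq_zero_iff ℝ]
  intro F
  obtain ⟨F, rfl⟩ := (dualDistribEquiv ℝ V V).surjective F
  change dualDistrib ℝ V V F (X - Y) = 0
  induction F with
  | zero => simp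
  | add F₁ F₂ h₁ h₂ => simp [h₁, h₂]
  | tmul f g =>
    rw [map_sub, sub_eq_zero]
    exact h f g

/-- The trace of the endomorphism of `V` given by a tensor and a bilinear form. -/
theorem trace_tensorHom_comp (X : V ⊗[ℝ] V) (β : V →ₗ[ℝ] Dual ℝ V) :
    LinearMap.trace ℝ V (tensorHom X ∘ₗ β) =
      TensorProduct.lift β (TensorProduct.comm ℝ V V X) := by
  induction X with
  | zero =>
    have : tensorHom (0 : V ⊗[ℝ] V) = 0 := by
      ext f
      simp [tensorHom_apply, tensorMap]
    simp [this]
  | add X Y hX hY =>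
    have : tensorHom (X + Y) = tensorHom X + tensorHom Y := by
      ext f
      simp [tensorHom_apply, tensorMap_add_left]
    rw [this, LinearMap.add_comp, map_add, hX, hY, map_add, map_add]
  | tmul x y =>
    have : tensorHom (x ⊗ₜ[ℝ] y) ∘ₗ β = (β.flip x).smulRight y := by
      ext v
      simp [tensorHom_apply, tensorMap_tmul]
    rw [this, LinearMap.trace_smulRight]
    simp

end Tensors

/-- A map that is symmetric for a scalar product has an eigenvector. -/
theorem exists_eigenvector_of_symmetric {W : Type*} [AddCommGroup W] [Module ℝ W]
    [FiniteDimensional ℝ W] [Nontrivial W] (β : W →ₗ[ℝ] W →ₗ[ℝ] ℝ)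
    (hsymm : ∀ v w, β v w = β w v) (hpos : ∀ v, v ≠ 0 → 0 < β v v) (L : W →ₗ[ℝ] W)
    (hL : ∀ v w, β (L v) w = β v (L w)) : ∃ (c : ℝ) (v : W), v ≠ 0 ∧ L v = c • v := by
  let core : InnerProductSpace.Core ℝ W :=
    { inner := fun v w => β v w
      conj_inner_symm := fun v w => by simp [hsymm v w]
      re_inner_nonneg := fun v => by
        rcases eq_or_ne v 0 with rfl | hv
        · simp
        · exact (hpos v hv).le
      add_left := fun u v w => by simp
      smul_left := fun u v c => by simp
      definite := fun v hv => by
        by_contra h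
        exact (hpos v h).ne' hv }
  let _ : NormedAddCommGroup W := core.toNormedAddCommGroup
  let _ : InnerProductSpace ℝ W := InnerProductSpace.ofCore core.toCore
  have hT : L.IsSymmetric := hL
  obtain ⟨v, hv⟩ := hT.hasEigenvalue_iSup_of_finiteDimensional.exists_hasEigenvector
  exact ⟨_, v, hv.2, Module.End.mem_eigenspace_iff.1 hv.1⟩

/-! ### Completely symmetric theories -/

namespace GPT

variable {V : Type*} [AddCommGroup V] [Module ℝ V] (A : GPT V)

theorem smul_mem_cone {c : ℝ} (hc : 0 ≤ c) {x : V} (hx : x ∈ A.cone) : c • x ∈ A.cone :=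
  A.cone.smul_mem hc hx

theorem smul_mem_dualCone {c : ℝ} (hc : 0 ≤ c) {f : Dual ℝ V} (hf : f ∈ A.dualCone) :
    c • f ∈ A.dualCone :=
  A.dualCone.smul_mem hc hf

theorem ext_cone {V' : Type*} [AddCommGroup V'] [Module ℝ V'] {L M : V →ₗ[ℝ] V'}
    (h : ∀ x ∈ A.cone, L x = M x) : L = M :=
  LinearMap.ext_on A.generating h

theorem convex_cone : Convex ℝ (A.cone : Set V) := fun _ hx _ hy _ _ ha hb _ =>
  A.cone.add_mem (A.smul_mem_cone ha hx) (A.smul_mem_cone hb hy)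

variable [FiniteDimensional ℝ V]

theorem unit_pos {x : V} (hx : x ∈ A.cone) (hx0 : x ≠ 0) : 0 < A.unit x :=
  pos_of_mem_interior_dual A.unit_interior hx hx0

theorem unit_nonneg {x : V} (hx : x ∈ A.cone) : 0 ≤ A.unit x := by
  rcases eq_or_ne x 0 with rfl | h
  · simp
  · exact (A.unit_pos hx h).le

theorem isCompact_states : @IsCompact V (moduleTopology ℝ V) {x | x ∈ A.cone ∧ A.unit x = 1} :=
  isCompact_slice A.closed (fun _ hc _ hx => A.smul_mem_cone hc hx) fun _ hx h => A.unit_pos hx h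

theorem exists_state [Nontrivial V] : ∃ x ∈ A.cone, A.unit x = 1 := by
  by_contra! h
  have h0 : ∀ x ∈ A.cone, x = 0 := fun x hx => by
    by_contra hx0
    have hp := A.unit_pos hx hx0
    refine h ((A.unit x)⁻¹ • x) (A.smul_mem_cone (inv_nonneg.2 hp.le) hx) ?_
    simp [hp.ne']
  have : (LinearMap.id : V →ₗ[ℝ] V) = 0 := A.ext_cone fun x hx => by simp [h0 x hx]
  obtain ⟨x, hx⟩ := exists_ne (0 : V)
  exact hx (by simpa using LinearMap.congr_fun this x)

end GPT

namespace IsCompletelySymmetric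

variable {V : Type*} [AddCommGroup V] [Module ℝ V]
variable {G : Type*} [Group G] [TopologicalSpace G] {A : GPT V} {ζ : Representation ℝ G V}

/-- The line through `x` is invariant; if it were all of V₀, the group would act trivially there. -/
theorem eq_zero_of_invariant (hA : IsCompletelySymmetric A ζ) {x : V} (hx : A.unit x = 0)
    (hinv : ∀ g, ζ g x = x) : x = 0 := by
  have hle : Submodule.span ℝ {x} ≤ LinearMap.ker A.unit := by
    rw [Submodule.span_singleton_le_iff_mem]
    exact hx
  have hst : ∀ g, ∀ y ∈ Submodule.span ℝ {x}, ζ g y ∈ Submodule.span ℝ {x} := by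
    intro g y hy
    obtain ⟨c, rfl⟩ := Submodule.mem_span_singleton.1 hy
    simpa [hinv] using hy
  rcases hA.irreducible _ hle hst with h | h
  · simpa using h
  · obtain ⟨g, y, hy, hne⟩ := hA.nontrivial
    rw [← h, Submodule.mem_span_singleton] at hy
    obtain ⟨c, rfl⟩ := hy
    exact absurd (by simp [hinv]) hne

variable [FiniteDimensional ℝ V]

theorem cone_unit (hA : IsCompletelySymmetric A ζ) (g : G) {x : V} (hx : x ∈ A.cone) :
    ζ g x ∈ A.cone ∧ A.unit (ζ g x) = A.unit x := by
  rcases eq_or_ne x 0 with rfl | h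
  · simp
  have hp := A.unit_pos hx h
  obtain ⟨h1, h2⟩ := hA.maps_states g ((A.unit x)⁻¹ • x)
    (A.smul_mem_cone (inv_nonneg.2 hp.le) hx) (by simp [hp.ne'])
  constructor
  · have := A.smul_mem_cone hp.le h1
    rwa [map_smul, smul_inv_smul₀ hp.ne'] at this
  · rw [map_smul, map_smul, smul_eq_mul, inv_mul_eq_one₀ hp.ne'] at h2
    exact h2.symm

theorem unit_apply (hA : IsCompletelySymmetric A ζ) (g : G) (x : V) :
    A.unit (ζ g x) = A.unit x :=
  LinearMap.congr_fun (A.ext_cone (L := A.unit ∘ₗ ζ g) fun _ hx => (hA.cone_unit g hx).2) x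

theorem unit_comp (hA : IsCompletelySymmetric A ζ) (g : G) : A.unit ∘ₗ ζ g = A.unit :=
  LinearMap.ext (hA.unit_apply g)

theorem comp_mem_dualCone (hA : IsCompletelySymmetric A ζ) (g : G) {f : Dual ℝ V}
    (hf : f ∈ A.dualCone) : f ∘ₗ ζ g ∈ A.dualCone := fun _ hx => hf (hA.cone_unit g hx).1

/-- Makes d - 1 a legitimate denominator. In dimension at most 1 a nonzero vector of V₀ would force
u = 0, against the existence of a state. -/
theorem one_lt_finrank (hA : IsCompletelySymmetric A ζ) : 1 < finrank ℝ V := by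
  by_contra! h
  obtain ⟨g, x, hx, hne⟩ := hA.nontrivial
  have hx0 : x ≠ 0 := by
    rintro rfl
    simp at hne
  rcases (finrank_le_one_iff (K := ℝ) (V := V)).1 h with ⟨v, hv⟩
  have hu : A.unit = 0 := by
    obtain ⟨a, rfl⟩ := hv x
    have ha : a ≠ 0 := by
      rintro rfl
      simp at hx0
    have hav : A.unit v = 0 := by
      have : a * A.unit v = 0 := by simpa using hx
      exact (mul_eq_zero.1 this).resolve_left ha
    ext y
    obtain ⟨b, rfl⟩ := hv y
    simp [hav]
  have : Nontrivial V := ⟨x, 0, hx0⟩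
  obtain ⟨y, -, hy⟩ := A.exists_state
  simp [hu] at hy

end IsCompletelySymmetric

/-! ### Werner frames -/

section Bijective

variable {V : Type*} [AddCommGroup V] [Module ℝ V]

theorem tensorMap_map (L M : V →ₗ[ℝ] V) (X : V ⊗[ℝ] V) (f : Dual ℝ V) :
    tensorMap (TensorProduct.map L M X) f = M (tensorMap X (f ∘ₗ L)) := by
  induction X with
  | zero => simp [tensorMap]
  | add X Y hX hY => simp [tensorMap_add_left, hX, hY]
  | tmul x y => simp [tensorMap_tmul]

theorem tensorMap_equivariant {G : Type*} [Group G] {ζ : Representation ℝ G V}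
    {Y : V ⊗[ℝ] V} {g : G}
    (hY : TensorProduct.map (ζ g) (ζ g) Y = Y) (f : Dual ℝ V) :
    ζ g (tensorMap Y (f ∘ₗ ζ g)) = tensorMap Y f := by
  rw [← tensorMap_map, hY]

theorem map_comm_comm (L : V →ₗ[ℝ] V) (X : V ⊗[ℝ] V) :
    TensorProduct.map L L (TensorProduct.comm ℝ V V X) =
      TensorProduct.comm ℝ V V (TensorProduct.map L L X) := by
  induction X with
  | zero => simp
  | add X Y hX hY => simp [hX, hY]
  | tmul x y => simp

theorem prodFunctional_eq_zero_of_mem_range {u : Dual ℝ V} {E : V ⊗[ℝ] V}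
    (hE : E ∈ LinearMap.range (TensorProduct.map (LinearMap.ker u).subtype
      (LinearMap.ker u).subtype)) (f : Dual ℝ V) : prodFunctional f u E = 0 := by
  obtain ⟨X, rfl⟩ := hE
  induction X with
  | zero => simp
  | add X Y hX hY => simp [hX, hY]
  | tmul x y => simp [prodFunctional_tmul]

/-- The isomorphism `V* → V` given by a scalar product on `V₀*` and an invariant vector. -/
theorem bijective_tensorHom_add [FiniteDimensional ℝ V] {u : Dual ℝ V} {uS : V} {E : V ⊗[ℝ] V}
    (hu : u uS = 1) (hE : ∀ f, prodFunctional f u E = 0)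
    (hpos : ∀ f : Dual ℝ V, f uS = 0 → f ≠ 0 → 0 < prodFunctional f f E) {c φ : ℝ} (hc : c ≠ 0)
    (hφ : φ ≠ 0) :
    Function.Bijective (φ • tensorHom E + c • (Dual.eval ℝ V uS).smulRight uS) := by
  have hinj : Function.Injective (φ • tensorHom E + c • (Dual.eval ℝ V uS).smulRight uS) := by
    rw [injective_iff_map_eq_zero]
    intro f hf
    have h : φ • tensorMap E f + c • f uS • uS = 0 := hf
    -- Applying `u` removes the `E` term, so only the coefficient of `uS` survives.
    have h0 : f uS = 0 := by
      have := congrArg u h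
      simpa [apply_tensorMap, hE, hu, hc] using this
    by_contra hne
    have h1 := hpos f h0 hne
    rw [h0, zero_smul, smul_zero, add_zero, smul_eq_zero] at h
    rw [← apply_tensorMap, h.resolve_left hφ, map_zero] at h1
    exact h1.false
  exact ⟨hinj, (LinearMap.injective_iff_surjective_of_finrank_eq_finrank
    Subspace.dual_finrank_eq).1 hinj⟩

end Bijective

namespace IsWernerFrame

variable {V : Type*} [AddCommGroup V] [Module ℝ V]
variable {G : Type*} [Group G] {A : GPT V} {ζ : Representation ℝ G V}
variable {uS : V} {E : V ⊗[ℝ] V} {Es : Dual ℝ (V ⊗[ℝ] V)}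

theorem symm_apply (hF : IsWernerFrame A ζ uS E Es) (f g : Dual ℝ V) :
    prodFunctional f g E = prodFunctional g f E := by
  rw [← prodFunctional_comm, hF.symm_E]

theorem unit_right (hF : IsWernerFrame A ζ uS E Es) (f : Dual ℝ V) :
    prodFunctional f A.unit E = 0 :=
  prodFunctional_eq_zero_of_mem_range hF.mem_E f

theorem unit_left (hF : IsWernerFrame A ζ uS E Es) (f : Dual ℝ V) :
    prodFunctional A.unit f E = 0 := by
  rw [hF.symm_apply, hF.unit_right]

/-- Extends the inverse relation from V₀ to V: `Es` ignores the `uS` components of both arguments.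
-/
theorem Es_apply (hF : IsWernerFrame A ζ uS E Es) {f : Dual ℝ V} {v : V} (hf : f uS = 0)
    (hv : tensorMap E f = v - A.unit v • uS) (w : V) : Es (v ⊗ₜ[ℝ] w) = f w := by
  have h1 : v = tensorMap E f + A.unit v • uS := by rw [hv, sub_add_cancel]
  have h2 : w = (w - A.unit w • uS) + A.unit w • uS := by rw [sub_add_cancel]
  have h3 : w - A.unit w • uS ∈ LinearMap.ker A.unit := by simp [hF.unit_uS]
  have h4 := hF.Es_inverse f hf _ h3
  rw [h1, add_tmul, map_add, ← smul_tmul', map_smul, hF.Es_left, smul_zero, add_zero]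
  conv_lhs => rw [h2]
  rw [tmul_add, map_add, h4, tmul_smul, map_smul, hF.Es_right]
  simp [hf]

theorem exists_curry (hF : IsWernerFrame A ζ uS E Es) {f : Dual ℝ V} (hf : f uS = 0) :
    ∃ v, A.unit v = 0 ∧ f = TensorProduct.curry Es v := by
  have h : A.unit (tensorMap E f) = 0 := by rw [apply_tensorMap, hF.unit_right]
  exact ⟨tensorMap E f, h, LinearMap.ext fun w => (hF.Es_apply hf (by simp [h]) w).symm⟩

variable [FiniteDimensional ℝ V]

theorem exists_dual (hF : IsWernerFrame A ζ uS E Es) (v : V) :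
    ∃ f : Dual ℝ V, f uS = 0 ∧ tensorMap E f = v - A.unit v • uS := by
  obtain ⟨f, hf⟩ := (bijective_tensorHom_add hF.unit_uS hF.unit_right hF.pos_E one_ne_zero
    one_ne_zero).2 (v - A.unit v • uS)
  have h : tensorMap E f + f uS • uS = v - A.unit v • uS := by simpa [tensorHom_apply] using hf
  have h0 : f uS = 0 := by
    simpa [apply_tensorMap, hF.unit_right, hF.unit_uS] using congrArg A.unit h
  exact ⟨f, h0, by simpa [h0] using h⟩

theorem Es_symm (hF : IsWernerFrame A ζ uS E Es) (v w : V) :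
    Es (v ⊗ₜ[ℝ] w) = Es (w ⊗ₜ[ℝ] v) := by
  obtain ⟨f, hf, hfv⟩ := hF.exists_dual v
  obtain ⟨g, hg, hgw⟩ := hF.exists_dual w
  rw [hF.Es_apply hf hfv, hF.Es_apply hg hgw]
  have h1 : f w = f (tensorMap E g) := by simp [hgw, hf]
  have h2 : g v = g (tensorMap E f) := by simp [hfv, hg]
  rw [h1, h2, apply_tensorMap, apply_tensorMap, hF.symm_apply]

theorem Es_pos (hF : IsWernerFrame A ζ uS E Es) {v : V} (hv : A.unit v = 0) (hv0 : v ≠ 0) :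
    0 < Es (v ⊗ₜ[ℝ] v) := by
  obtain ⟨f, hf, hfv⟩ := hF.exists_dual v
  rw [hF.Es_apply hf hfv]
  rw [hv, zero_smul, sub_zero] at hfv
  have hne : f ≠ 0 := by
    rintro rfl
    exact hv0 (by rw [← hfv, ← tensorHom_apply, map_zero])
  have := hF.pos_E f hf hne
  rwa [← apply_tensorMap, hfv] at this

theorem Es_comm (hF : IsWernerFrame A ζ uS E Es) (X : V ⊗[ℝ] V) :
    Es (TensorProduct.comm ℝ V V X) = Es X := by
  induction X with
  | zero => simp
  | add X Y hX hY => simp [hX, hY]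
  | tmul x y => simpa using hF.Es_symm y x

/-- The bilinear form `E_*` and the tensor `E` are inverse to each other. -/
theorem tensorMap_curry (hF : IsWernerFrame A ζ uS E Es) (v : V) :
    tensorMap E (TensorProduct.curry Es v) = v - A.unit v • uS := by
  obtain ⟨f, hf, hfv⟩ := hF.exists_dual v
  have : TensorProduct.curry Es v = f := LinearMap.ext fun w => hF.Es_apply hf hfv w
  rw [this, hfv]

/-- Contracting E with E_* gives the trace of the projection of V onto V₀ along u_*. -/
theorem Es_E (hF : IsWernerFrame A ζ uS E Es) : Es E = (finrank ℝ V : ℝ) - 1 := by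
  have h := trace_tensorHom_comp E (TensorProduct.curry Es)
  have h1 : tensorHom E ∘ₗ TensorProduct.curry Es = LinearMap.id - A.unit.smulRight uS := by
    ext v
    simp [tensorHom_apply, hF.tensorMap_curry]
  rw [h1, hF.symm_E, map_sub, LinearMap.trace_id, LinearMap.trace_smulRight, hF.unit_uS] at h
  rw [h]
  exact (LinearMap.congr_fun (TensorProduct.ext' fun x y => by simp) E)

end IsWernerFrame

/-! ### Invariant tensors and Schur's lemma -/

section Invariants

variable {V : Type*} [AddCommGroup V] [Module ℝ V] [FiniteDimensional ℝ V]
variable {G : Type*} [Group G] [TopologicalSpace G] {A : GPT V} {ζ : Representation ℝ G V}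
variable {uS : V} {E : V ⊗[ℝ] V} {Es : Dual ℝ (V ⊗[ℝ] V)}

theorem prodFunctional_unit_map (hA : IsCompletelySymmetric A ζ) (g : G) (X : V ⊗[ℝ] V) :
    prodFunctional A.unit A.unit (TensorProduct.map (ζ g) (ζ g) X) =
      prodFunctional A.unit A.unit X := by
  rw [prodFunctional_map, hA.unit_comp]

/-- E_* is determined by E, which is invariant: if `f` represents `v` through E, then `f ∘ₗ ζ g⁻¹`
represents `ζ g v`. -/
theorem Es_map (hA : IsCompletelySymmetric A ζ) (hF : IsWernerFrame A ζ uS E Es) (g : G)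
    (X : V ⊗[ℝ] V) : Es (TensorProduct.map (ζ g) (ζ g) X) = Es X := by
  induction X with
  | zero => simp
  | add X Y hX hY => simp [hX, hY]
  | tmul v w =>
    obtain ⟨f, hf, hfv⟩ := hF.exists_dual v
    have hg : ∀ x, ζ g⁻¹ (ζ g x) = x := fun x => by
      rw [← Module.End.mul_apply, ← map_mul]
      simp
    have hcomp : (f ∘ₗ ζ g⁻¹) ∘ₗ ζ g = f := LinearMap.ext fun x => by simp [hg]
    have h1 : (f ∘ₗ ζ g⁻¹) uS = 0 := by simp [hF.invariant_uS, hf]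
    have h2 : tensorMap E (f ∘ₗ ζ g⁻¹) = ζ g v - A.unit (ζ g v) • uS := by
      conv_lhs => rw [← hF.invariant_E g]
      rw [tensorMap_map, hcomp, hfv, hA.unit_apply]
      simp [hF.invariant_uS]
    rw [TensorProduct.map_tmul, hF.Es_apply h1 h2, hF.Es_apply hf hfv, LinearMap.comp_apply, hg]

/-- The difference of the two sides is an invariant vector of V₀, hence zero. -/
theorem tensorMap_unit (hA : IsCompletelySymmetric A ζ) (hF : IsWernerFrame A ζ uS E Es)
    {Y : V ⊗[ℝ] V} (hY : ∀ g, TensorProduct.map (ζ g) (ζ g) Y = Y) :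
    tensorMap Y A.unit = prodFunctional A.unit A.unit Y • uS := by
  rw [← sub_eq_zero]
  refine hA.eq_zero_of_invariant ?_ fun g => ?_
  · simp [apply_tensorMap, hF.unit_uS]
  · have := tensorMap_equivariant (hY g) A.unit
    rw [hA.unit_comp] at this
    simp [hF.invariant_uS, this]

/-- The endomorphism of `V` given by an invariant tensor commutes with the representation. -/
theorem tensorMap_curry_equivariant (hA : IsCompletelySymmetric A ζ)
    (hF : IsWernerFrame A ζ uS E Es) {Y : V ⊗[ℝ] V}
    (hY : ∀ g, TensorProduct.map (ζ g) (ζ g) Y = Y) (g : G) (v : V) :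
    tensorMap Y (TensorProduct.curry Es (ζ g v)) =
      ζ g (tensorMap Y (TensorProduct.curry Es v)) := by
  rw [← tensorMap_equivariant (hY g)]
  congr 2
  ext w
  simpa using Es_map hA hF g (v ⊗ₜ w)

/-- Every functional is a multiple of u plus some E_*(v, ·) with v in V₀, so the tensor is known
once these images are. Applying E_* then identifies the scalar `c`. -/
theorem eq_of_tensorMap_scalar (hA : IsCompletelySymmetric A ζ)
    (hF : IsWernerFrame A ζ uS E Es) {Y : V ⊗[ℝ] V}
    (hY : ∀ g, TensorProduct.map (ζ g) (ζ g) Y = Y) {c : ℝ}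
    (hc : ∀ v, A.unit v = 0 → tensorMap Y (TensorProduct.curry Es v) = c • v) :
    Y = prodFunctional A.unit A.unit Y • uS ⊗ₜ[ℝ] uS +
      (Es Y / ((finrank ℝ V : ℝ) - 1)) • E := by
  have key : Y = prodFunctional A.unit A.unit Y • uS ⊗ₜ[ℝ] uS + c • E := by
    refine tensor_ext fun f g => ?_
    have hf : f = f uS • A.unit + (f - f uS • A.unit) := by rw [add_sub_cancel]
    obtain ⟨v, hv, hfv⟩ := hF.exists_curry (f := f - f uS • A.unit) (by simp [hF.unit_uS])
    rw [hfv] at hf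
    have h1 : tensorMap Y f = f uS • prodFunctional A.unit A.unit Y • uS + c • v := by
      rw [hf, ← tensorHom_apply, map_add, map_smul, tensorHom_apply, tensorHom_apply,
        tensorMap_unit hA hF hY, hc v hv]
      simp [hF.unit_uS, hF.Es_right]
    have h2 : tensorMap E f = v := by
      rw [hf, ← tensorHom_apply, map_add, map_smul, tensorHom_apply, tensorHom_apply,
        tensorMap_unit hA hF hF.invariant_E, hF.unit_right, hF.tensorMap_curry, hv]
      simp
    have h3 : prodFunctional f g E = g v := by rw [← apply_tensorMap, h2]
    rw [← apply_tensorMap, h1]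
    simp only [map_add, map_smul, prodFunctional_tmul, h3, smul_eq_mul]
    ring
  have hd : (finrank ℝ V : ℝ) - 1 ≠ 0 := by
    have : (1 : ℝ) < finrank ℝ V := by exact_mod_cast hA.one_lt_finrank
    linarith
  have h := congrArg Es key
  rw [map_add, map_smul, map_smul, hF.Es_left, hF.Es_E, smul_zero, zero_add, smul_eq_mul] at h
  rw [h, mul_div_cancel_right₀ _ hd]
  exact key

theorem eq_of_invariant_of_realType (hA : IsCompletelySymmetric A ζ)
    (hF : IsWernerFrame A ζ uS E Es) (hr : IsRealType A ζ) {Y : V ⊗[ℝ] V}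
    (hY : ∀ g, TensorProduct.map (ζ g) (ζ g) Y = Y) :
    Y = prodFunctional A.unit A.unit Y • uS ⊗ₜ[ℝ] uS +
      (Es Y / ((finrank ℝ V : ℝ) - 1)) • E := by
  obtain ⟨c, hc⟩ := hr (tensorHom Y ∘ₗ TensorProduct.curry Es)
    fun g x => tensorMap_curry_equivariant hA hF hY g x
  exact eq_of_tensorMap_scalar hA hF hY (c := c) hc

/-- Without real type the commutant on V₀ may be larger than ℝ. Symmetry of Y makes its endomorphism
self-adjoint for E_*, so a real eigenvalue exists; the eigenspace in V₀ is invariant, hence all of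
V₀. -/
theorem eq_of_invariant_of_symm (hA : IsCompletelySymmetric A ζ)
    (hF : IsWernerFrame A ζ uS E Es) {Y : V ⊗[ℝ] V}
    (hY : ∀ g, TensorProduct.map (ζ g) (ζ g) Y = Y) (hs : TensorProduct.comm ℝ V V Y = Y) :
    Y = prodFunctional A.unit A.unit Y • uS ⊗ₜ[ℝ] uS +
      (Es Y / ((finrank ℝ V : ℝ) - 1)) • E := by
  let L : V →ₗ[ℝ] V := tensorHom Y ∘ₗ TensorProduct.curry Es
  have hsym : ∀ f g, prodFunctional f g Y = prodFunctional g f Y := fun f g => by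
    rw [← prodFunctional_comm, hs]
  have hLker : ∀ v ∈ LinearMap.ker A.unit, L v ∈ LinearMap.ker A.unit := fun v _ => by
    change A.unit (tensorMap Y _) = 0
    rw [apply_tensorMap, hsym, ← apply_tensorMap, tensorMap_unit hA hF hY]
    simp [hF.Es_right]
  let β : LinearMap.ker A.unit →ₗ[ℝ] LinearMap.ker A.unit →ₗ[ℝ] ℝ :=
    (TensorProduct.curry Es).domRestrict₁₂ _ _
  have : Nontrivial (LinearMap.ker A.unit) := by
    obtain ⟨g, x, hx, hne⟩ := hA.nontrivial
    refine ⟨⟨x, hx⟩, 0, fun h => hne ?_⟩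
    have : x = 0 := congrArg Subtype.val h
    simp [this]
  obtain ⟨c, v, hv0, hv⟩ := exists_eigenvector_of_symmetric β
    (fun v w => hF.Es_symm v w)
    (fun v hv => hF.Es_pos v.2 fun h => hv (Subtype.ext h)) (L.restrict hLker)
    (fun v w => by
      change Es (L v ⊗ₜ w) = TensorProduct.curry Es v (tensorMap Y (TensorProduct.curry Es w))
      rw [hF.Es_symm]
      change TensorProduct.curry Es w (tensorMap Y (TensorProduct.curry Es v)) = _
      rw [apply_tensorMap, apply_tensorMap, hsym])
  have hLv : L v = c • (v : V) := congrArg Subtype.val hv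
  let W : Submodule ℝ V := LinearMap.ker A.unit ⊓ LinearMap.ker (L - c • LinearMap.id)
  have hW : ∀ g, ∀ x ∈ W, ζ g x ∈ W := by
    rintro g x ⟨hx, hLx⟩
    have hLx : L x = c • x := by simpa [sub_eq_zero] using hLx
    have h : L (ζ g x) = ζ g (L x) := tensorMap_curry_equivariant hA hF hY g x
    refine ⟨(hA.unit_apply g x).trans hx, ?_⟩
    simp [h, hLx]
  rcases hA.irreducible W inf_le_left hW with h | h
  · have : (v : V) ∈ W := ⟨v.2, by simp [hLv]⟩
    rw [h, Submodule.mem_bot] at this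
    exact absurd (Subtype.ext this) hv0
  · refine eq_of_tensorMap_scalar hA hF hY (c := c) fun x hx => ?_
    have : x ∈ W := h ▸ hx
    exact sub_eq_zero.1 this.2

end Invariants

/-! ### Twirling -/

section Twirl

variable {V : Type*} [AddCommGroup V] [Module ℝ V] [FiniteDimensional ℝ V]
variable {G : Type*} [Group G] [TopologicalSpace G] [IsTopologicalGroup G] [CompactSpace G]
variable {A : GPT V} {ζ : Representation ℝ G V}

/-- The average of `(ζ_g ⊗ ζ_g) X` over the group. -/
noncomputable def twirl (hA : IsCompletelySymmetric A ζ) (X : V ⊗[ℝ] V) : V ⊗[ℝ] V :=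
  average (fun g => TensorProduct.map (ζ g) (ζ g) X)
    (continuous_apply_map_tensor hA.continuous X)

theorem map_twirl (hA : IsCompletelySymmetric A ζ) (X : V ⊗[ℝ] V) (h : G) :
    TensorProduct.map (ζ h) (ζ h) (twirl hA X) = twirl hA X := by
  refine average_fixed (h := h) fun g => ?_
  rw [← LinearMap.comp_apply, ← TensorProduct.map_comp, map_mul]
  rfl

theorem apply_twirl_of_invariant (hA : IsCompletelySymmetric A ζ) {F : Dual ℝ (V ⊗[ℝ] V)}
    (hF : ∀ g X, F (TensorProduct.map (ζ g) (ζ g) X) = F X) (X : V ⊗[ℝ] V) :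
    F (twirl hA X) = F X :=
  apply_average_const fun g => hF g X

variable {uS : V} {E : V ⊗[ℝ] V} {Es : Dual ℝ (V ⊗[ℝ] V)}

/-- The projection of `V ⊗ V` onto the span of `U_*` and `E`. -/
noncomputable def wernerProj (A : GPT V) (uS : V) (E : V ⊗[ℝ] V) (Es : Dual ℝ (V ⊗[ℝ] V))
    (X : V ⊗[ℝ] V) : V ⊗[ℝ] V :=
  prodFunctional A.unit A.unit X • uS ⊗ₜ[ℝ] uS + (Es X / ((finrank ℝ V : ℝ) - 1)) • E

/-- The symmetrised average is invariant and symmetric, hence in the plane; its coordinates are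
those of X because U and E_* are unaffected by the group and by the exchange. -/
theorem half_twirl_add_comm (hA : IsCompletelySymmetric A ζ) (hF : IsWernerFrame A ζ uS E Es)
    (X : V ⊗[ℝ] V) :
    (1 / 2 : ℝ) • twirl hA X + (1 / 2 : ℝ) • TensorProduct.comm ℝ V V (twirl hA X) =
      wernerProj A uS E Es X := by
  set Y := (1 / 2 : ℝ) • twirl hA X + (1 / 2 : ℝ) • TensorProduct.comm ℝ V V (twirl hA X)
    with hYdef
  have hY : ∀ g, TensorProduct.map (ζ g) (ζ g) Y = Y := fun g => by
    simp only [hYdef, map_add, map_smul, map_comm_comm, map_twirl]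
  have hs : TensorProduct.comm ℝ V V Y = Y := by
    have : TensorProduct.comm ℝ V V (TensorProduct.comm ℝ V V (twirl hA X)) = twirl hA X :=
      (TensorProduct.comm ℝ V V).symm_apply_apply _
    simp only [hYdef, map_add, map_smul, this]
    rw [add_comm]
  have hU : prodFunctional A.unit A.unit Y = prodFunctional A.unit A.unit X := by
    simp only [hYdef, map_add, map_smul, prodFunctional_comm,
      apply_twirl_of_invariant hA (prodFunctional_unit_map hA), smul_eq_mul]
    ring
  have hE : Es Y = Es X := by
    simp only [hYdef, map_add, map_smul, hF.Es_comm, apply_twirl_of_invariant hA (Es_map hA hF),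
      smul_eq_mul]
    ring
  rw [eq_of_invariant_of_symm hA hF hY hs, hU, hE, wernerProj]

/-- For real type the average over the group alone already lies in the plane, so `D` need not be
stable under the exchange. -/
theorem wernerProj_mem (hA : IsCompletelySymmetric A ζ) (hF : IsWernerFrame A ζ uS E Es)
    {D : Set (V ⊗[ℝ] V)} (hconv : Convex ℝ D)
    (hcl : @IsClosed _ (moduleTopology ℝ (V ⊗[ℝ] V)) D)
    (htype : IsRealType A ζ ∨ ∀ X ∈ D, TensorProduct.comm ℝ V V X ∈ D) {X : V ⊗[ℝ] V}
    (h : ∀ g, TensorProduct.map (ζ g) (ζ g) X ∈ D) : wernerProj A uS E Es X ∈ D := by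
  have ht : twirl hA X ∈ D := average_mem hconv hcl h
  rcases htype with hr | hs
  · rw [wernerProj, ← apply_twirl_of_invariant hA (prodFunctional_unit_map hA) X,
      ← apply_twirl_of_invariant hA (Es_map hA hF) X,
      ← eq_of_invariant_of_realType hA hF hr (map_twirl hA X)]
    exact ht
  · rw [← half_twirl_add_comm hA hF]
    exact hconv ht (hs _ ht) (by norm_num) (by norm_num) (by norm_num)

/-- The projection of functionals dual to `wernerProj`. -/
theorem dual_wernerProj_mem (hA : IsCompletelySymmetric A ζ) (hF : IsWernerFrame A ζ uS E Es)
    {D : Set (Dual ℝ (V ⊗[ℝ] V))} (hconv : Convex ℝ D)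
    (hcl : @IsClosed _ (moduleTopology ℝ (Dual ℝ (V ⊗[ℝ] V))) D) {F : Dual ℝ (V ⊗[ℝ] V)}
    (h₁ : ∀ g, F ∘ₗ TensorProduct.map (ζ g) (ζ g) ∈ D)
    (h₂ : ∀ g, F ∘ₗ (TensorProduct.comm ℝ V V).toLinearMap ∘ₗ
      TensorProduct.map (ζ g) (ζ g) ∈ D) :
    F (uS ⊗ₜ[ℝ] uS) • prodFunctional A.unit A.unit +
      (F E / ((finrank ℝ V : ℝ) - 1)) • Es ∈ D := by
  by_contra hn
  obtain ⟨Φ, c, hD, hc⟩ := exists_separating_dual hconv hcl hn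
  -- The separating element of the bidual is a tensor, which moves the average from functionals to
  -- tensors.
  obtain ⟨X, rfl⟩ := (evalEquiv ℝ (V ⊗[ℝ] V)).surjective Φ
  simp only [evalEquiv_apply, Dual.eval_apply] at hD hc
  have e : (F (uS ⊗ₜ[ℝ] uS) • prodFunctional A.unit A.unit +
      (F E / ((finrank ℝ V : ℝ) - 1)) • Es) X = F (wernerProj A uS E Es X) := by
    simp only [wernerProj, LinearMap.add_apply, LinearMap.smul_apply, map_add, map_smul,
      smul_eq_mul]
    ring
  rw [e, ← half_twirl_add_comm hA hF, map_add, map_smul, map_smul] at hc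
  have b₁ : F (twirl hA X) ≤ c := by
    rw [twirl, apply_average]
    exact invariantMean_le fun g => (hD _ (h₁ g)).le
  have b₂ : F (TensorProduct.comm ℝ V V (twirl hA X)) ≤ c := by
    have := apply_average (hx := continuous_apply_map_tensor hA.continuous X)
      (F ∘ₗ (TensorProduct.comm ℝ V V).toLinearMap)
    rw [twirl]
    refine this.trans_le (invariantMean_le fun g => (hD _ (h₂ g)).le)
  simp only [smul_eq_mul] at hc
  linarith

end Twirl

/-! ### Existence of Werner frames -/

section Existence

variable {V : Type*} [AddCommGroup V] [Module ℝ V] [FiniteDimensional ℝ V]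
variable {G : Type*} [Group G] [TopologicalSpace G] [IsTopologicalGroup G] [CompactSpace G]
variable {A : GPT V} {ζ : Representation ℝ G V}

theorem exists_invariant_state (hA : IsCompletelySymmetric A ζ) :
    ∃ uS : V, (∀ g, ζ g uS = uS) ∧ A.unit uS = 1 := by
  have : Nontrivial V := by
    obtain ⟨g, x, -, hne⟩ := hA.nontrivial
    exact ⟨_, _, hne⟩
  obtain ⟨ω, -, hω⟩ := A.exists_state
  refine ⟨average (fun g => ζ g ω) fun f => hA.continuous f ω, fun h => ?_, ?_⟩
  · refine average_fixed (h := h) fun g => ?_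
    rw [map_mul]
    rfl
  · exact apply_average_const fun g => by rw [hA.unit_apply, hω]

/-- The average of ∑ bᵢ ⊗ bᵢ over a basis of V₀. For f ≠ 0 vanishing at u_* the integrand ∑ f(ζ_g
bᵢ)² is positive at the identity, so its mean is positive. -/
theorem exists_invariant_scalarProduct (hA : IsCompletelySymmetric A ζ) {uS : V}
    (huS : A.unit uS = 1) : ∃ E : V ⊗[ℝ] V,
      E ∈ LinearMap.range (TensorProduct.map (LinearMap.ker A.unit).subtype
        (LinearMap.ker A.unit).subtype) ∧
      (∀ g, TensorProduct.map (ζ g) (ζ g) E = E) ∧ TensorProduct.comm ℝ V V E = E ∧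
      ∀ f : Dual ℝ V, f uS = 0 → f ≠ 0 → 0 < prodFunctional f f E := by
  let b := finBasis ℝ (LinearMap.ker A.unit)
  let X : V ⊗[ℝ] V := ∑ i, (b i : V) ⊗ₜ[ℝ] (b i : V)
  have hX : ∀ (f : Dual ℝ V) (g : G), prodFunctional f f (TensorProduct.map (ζ g) (ζ g) X) =
      ∑ i, f (ζ g (b i)) ^ 2 := fun f g => by
    simp [X, prodFunctional_tmul, sq]
  refine ⟨twirl hA X, ?_, map_twirl hA X, ?_, fun f hf hf0 => ?_⟩
  · by_contra hn
    -- A functional killing V₀ ⊗ V₀ vanishes along the whole orbit, hence on its average.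
    obtain ⟨f, hf, hle⟩ := Submodule.exists_le_ker_of_notMem hn
    refine hf (apply_average_const fun g => hle ?_)
    refine ⟨∑ i, (⟨ζ g (b i), by simp [hA.unit_apply]⟩ : LinearMap.ker A.unit) ⊗ₜ[ℝ]
      (⟨ζ g (b i), by simp [hA.unit_apply]⟩ : LinearMap.ker A.unit), ?_⟩
    simp [X]
  · refine tensor_ext fun f g => ?_
    rw [prodFunctional_comm]
    rw [twirl, apply_average, apply_average]
    congr 1
    ext h
    simp [X, prodFunctional_tmul, mul_comm]
  · rw [twirl, apply_average]
    refine invariantMean_pos (fun g => ?_) ?_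
    · change 0 ≤ prodFunctional f f (TensorProduct.map (ζ g) (ζ g) X)
      rw [hX]
      positivity
    · change 0 < prodFunctional f f (TensorProduct.map (ζ 1) (ζ 1) X)
      rw [hX]
      by_contra! hle
      have h0 : ∀ i, f (b i) = 0 := fun i => by
        have := (Finset.sum_eq_zero_iff_of_nonneg fun i _ => sq_nonneg (f (ζ 1 (b i)))).1
          (le_antisymm hle (Finset.sum_nonneg fun i _ => sq_nonneg _)) i (Finset.mem_univ i)
        simpa using this
      have hk : f ∘ₗ (LinearMap.ker A.unit).subtype = 0 := b.ext h0
      refine hf0 (LinearMap.ext fun v => ?_)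
      have hv : v - A.unit v • uS ∈ LinearMap.ker A.unit := by simp [huS]
      have := LinearMap.congr_fun hk ⟨_, hv⟩
      simpa [hf] using this

/-- E + U_* is an isomorphism V* → V taking u to u_*; E_* is its inverse minus u ⊗ u. -/
theorem exists_wernerFrame (hA : IsCompletelySymmetric A ζ) :
    ∃ uS E Es, IsWernerFrame A ζ uS E Es := by
  obtain ⟨uS, hinv, hu⟩ := exists_invariant_state hA
  obtain ⟨E, hE, hEinv, hEs, hpos⟩ := exists_invariant_scalarProduct hA hu
  have hr := prodFunctional_eq_zero_of_mem_range hE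
  have hl : ∀ f, prodFunctional A.unit f E = 0 := fun f => by
    rw [← prodFunctional_comm, hEs, hr]
  let N := LinearEquiv.ofBijective _ (bijective_tensorHom_add hu hr hpos one_ne_zero one_ne_zero)
  have hN : ∀ f, N f = tensorMap E f + f uS • uS := fun f => by
    simp [N, tensorHom_apply]
  have hNu : N.symm uS = A.unit := by
    rw [LinearEquiv.symm_apply_eq, hN, hu, one_smul]
    have : tensorMap E A.unit = 0 := by
      rw [← forall_dual_apply_eq_zero_iff ℝ]
      intro f
      rw [apply_tensorMap, hl]
    rw [this, zero_add]
  have hNS : ∀ v, N.symm v uS = A.unit v := fun v => by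
    obtain ⟨f, rfl⟩ := N.surjective v
    rw [N.symm_apply_apply, hN, map_add, apply_tensorMap, hr, map_smul, hu]
    simp
  refine ⟨uS, E, TensorProduct.lift (N.symm.toLinearMap - A.unit.smulRight A.unit), ?_⟩
  exact {
    invariant_uS := hinv
    unit_uS := hu
    mem_E := hE
    invariant_E := hEinv
    symm_E := hEs
    pos_E := hpos
    Es_left := fun v => by simp [hNu, hu]
    Es_right := fun v => by simp [hNS, hu]
    Es_inverse := fun f hf v hv => by
      have h1 : N f = tensorMap E f := by rw [hN, hf, zero_smul, add_zero]
      have h2 : A.unit v = 0 := hv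
      rw [← h1]
      simp [h2] }

end Existence

/-! ### Separable tensors and separable functionals -/

section Separable

variable {V : Type*} [AddCommGroup V] [Module ℝ V]

/-- The cone of separable functionals on `V ⊗ V`. -/
noncomputable def sepCone (A : GPT V) : PointedCone ℝ (Dual ℝ (V ⊗[ℝ] V)) :=
  (PointedCone.minTensorProduct A.dualCone A.dualCone).map (dualDistrib ℝ V V)

/-- `prodFunctional` as a bilinear map. -/
noncomputable def prodBilin (V : Type*) [AddCommGroup V] [Module ℝ V] :
    Dual ℝ V →ₗ[ℝ] Dual ℝ V →ₗ[ℝ] Dual ℝ (V ⊗[ℝ] V) :=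
  (TensorProduct.mk ℝ (Dual ℝ V) (Dual ℝ V)).compr₂ (dualDistrib ℝ V V)

theorem prodBilin_apply (f g : Dual ℝ V) : prodBilin V f g = prodFunctional f g := rfl

theorem prodFunctional_mem_sepCone {A : GPT V} {f g : Dual ℝ V} (hf : f ∈ A.dualCone)
    (hg : g ∈ A.dualCone) : prodFunctional f g ∈ sepCone A :=
  ⟨f ⊗ₜ g, PointedCone.tmul_mem_minTensorProduct hf hg, rfl⟩

theorem sepCone_nonneg {A : GPT V} {X : V ⊗[ℝ] V}
    (h : ∀ f ∈ A.dualCone, ∀ g ∈ A.dualCone, 0 ≤ prodFunctional f g X) {F : Dual ℝ (V ⊗[ℝ] V)}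
    (hF : F ∈ sepCone A) : 0 ≤ F X := by
  obtain ⟨Z, hZ, rfl⟩ := hF
  induction hZ using Submodule.span_induction with
  | mem Z hZ =>
    obtain ⟨f, hf, g, hg, rfl⟩ := hZ
    exact h f hf g hg
  | zero => simp
  | add Z₁ Z₂ _ _ h₁ h₂ =>
    rw [map_add]
    exact add_nonneg h₁ h₂
  | smul c Z _ hZ =>
    rw [map_smul]
    exact mul_nonneg c.2 hZ

theorem minTensorProduct_nonneg {A : GPT V} {F : Dual ℝ (V ⊗[ℝ] V)}
    (h : ∀ x ∈ A.cone, ∀ y ∈ A.cone, 0 ≤ F (x ⊗ₜ y)) {X : V ⊗[ℝ] V}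
    (hX : X ∈ PointedCone.minTensorProduct A.cone A.cone) : 0 ≤ F X := by
  induction hX using Submodule.span_induction with
  | mem Z hZ =>
    obtain ⟨x, hx, y, hy, rfl⟩ := hZ
    exact h x hx y hy
  | zero => simp
  | add Z₁ Z₂ _ _ h₁ h₂ =>
    rw [map_add]
    exact add_nonneg h₁ h₂
  | smul c Z _ hZ =>
    change 0 ≤ F ((c : ℝ) • Z)
    rw [map_smul]
    exact mul_nonneg c.2 hZ

theorem PointedCone.convex_coe {W : Type*} [AddCommGroup W] [Module ℝ W] (K : PointedCone ℝ W) :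
    Convex ℝ (K : Set W) := fun _ hx _ hy _ _ ha hb _ =>
  K.add_mem (K.smul_mem ha hx) (K.smul_mem hb hy)

variable [FiniteDimensional ℝ V]
variable {G : Type*} [Group G] [TopologicalSpace G] [IsTopologicalGroup G] [CompactSpace G]
variable {A : GPT V} {ζ : Representation ℝ G V}
variable {uS : V} {E : V ⊗[ℝ] V} {Es : Dual ℝ (V ⊗[ℝ] V)}

/-- The average is an invariant vector with u = 1, and such a vector is unique. -/
theorem average_state (hA : IsCompletelySymmetric A ζ) (hF : IsWernerFrame A ζ uS E Es) {ω : V}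
    (hω : A.unit ω = 1) : average (fun g => ζ g ω) (fun f => hA.continuous f ω) = uS := by
  rw [← sub_eq_zero]
  have h1 : A.unit (average (fun g => ζ g ω) (fun f => hA.continuous f ω)) = 1 :=
    apply_average_const fun g => by rw [hA.unit_apply, hω]
  refine hA.eq_zero_of_invariant (by rw [map_sub, h1, hF.unit_uS, sub_self]) fun h => ?_
  rw [map_sub, hF.invariant_uS, average_fixed (h := h) fun g => ?_]
  rw [map_mul]
  rfl

theorem uS_mem_cone (hA : IsCompletelySymmetric A ζ) (hF : IsWernerFrame A ζ uS E Es) :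
    uS ∈ A.cone := by
  have : Nontrivial V := by
    obtain ⟨g, x, -, hne⟩ := hA.nontrivial
    exact ⟨_, _, hne⟩
  obtain ⟨ω, hω, h1⟩ := A.exists_state
  rw [← average_state hA hF h1]
  exact average_mem A.convex_cone A.closed fun g => (hA.cone_unit g hω).1

/-- A nonzero positive `f` is positive at some state, and u_* is the average of the orbit of that
state. This makes the functionals normalised at u_* a compact base of the dual cone. -/
theorem apply_uS_pos (hA : IsCompletelySymmetric A ζ) (hF : IsWernerFrame A ζ uS E Es)
    {f : Dual ℝ V} (hf : f ∈ A.dualCone) (hf0 : f ≠ 0) : 0 < f uS := by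
  obtain ⟨x, hx, hfx⟩ : ∃ x ∈ A.cone, 0 < f x := by
    by_contra! h
    exact hf0 (A.ext_cone fun x hx => le_antisymm (h x hx) (hf hx))
  have hx0 : x ≠ 0 := by
    rintro rfl
    simp at hfx
  have hp := A.unit_pos hx hx0
  have hω : (A.unit x)⁻¹ • x ∈ A.cone := A.smul_mem_cone (inv_nonneg.2 hp.le) hx
  rw [← average_state hA hF (ω := (A.unit x)⁻¹ • x) (by simp [hp.ne']), apply_average]
  refine invariantMean_pos (fun g => hf (hA.cone_unit g hω).1) ?_
  simp only [ContinuousMap.coe_mk, map_one, Module.End.one_apply, map_smul, smul_eq_mul]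
  positivity

/-- The states of `A`. -/
def stateSet (A : GPT V) : Set V := {x | x ∈ A.cone ∧ A.unit x = 1}

/-- The functionals of the dual cone that are normalised at `u_*`. -/
def dualStateSet (A : GPT V) (uS : V) : Set (Dual ℝ V) := {f | f ∈ A.dualCone ∧ f uS = 1}

theorem isCompact_dualStateSet (hA : IsCompletelySymmetric A ζ)
    (hF : IsWernerFrame A ζ uS E Es) :
    @IsCompact _ (moduleTopology ℝ (Dual ℝ V)) (dualStateSet A uS) :=
  isCompact_slice (ℓ := Dual.eval ℝ V uS) (isClosed_dualCone_eval (A.cone : Set V))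
    (fun _ hc _ hf => A.smul_mem_dualCone hc hf) fun _ hf hf0 => apply_uS_pos hA hF hf hf0

/-- The tensor is the projection of x ⊗ y. The hull of product states replaces the cone because its
closedness follows from compactness of the states; it is stable under the exchange even if C_AB is
not. -/
theorem wernerTensor_separable (hA : IsCompletelySymmetric A ζ)
    (hF : IsWernerFrame A ζ uS E Es) {x y : V} (hx : x ∈ stateSet A) (hy : y ∈ stateSet A) :
    wernerTensor uS E (Es (x ⊗ₜ y) / ((finrank ℝ V : ℝ) - 1)) ∈
      PointedCone.minTensorProduct A.cone A.cone := by
  let H : Set (V ⊗[ℝ] V) := convexHull ℝ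
    (Set.image2 (fun a b => TensorProduct.mk ℝ V V a b) (stateSet A) (stateSet A))
  have hcl : @IsClosed _ (moduleTopology ℝ (V ⊗[ℝ] V)) H :=
    isClosed_convexHull_image2 A.isCompact_states (TensorProduct.mk ℝ V V)
  have hH : H ⊆ PointedCone.minTensorProduct A.cone A.cone := by
    refine convexHull_min ?_ (PointedCone.convex_coe _)
    rintro _ ⟨a, ha, b, hb, rfl⟩
    exact PointedCone.tmul_mem_minTensorProduct ha.1 hb.1
  have hcomm : ∀ X ∈ H, TensorProduct.comm ℝ V V X ∈ H := by
    intro X hX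
    have := Set.mem_image_of_mem (TensorProduct.comm ℝ V V).toLinearMap hX
    rw [LinearMap.image_convexHull] at this
    refine convexHull_mono ?_ this
    rintro _ ⟨_, ⟨a, ha, b, hb, rfl⟩, rfl⟩
    exact ⟨b, hb, a, ha, by simp⟩
  have hmem := wernerProj_mem hA hF (X := x ⊗ₜ y) (convex_convexHull ℝ _) hcl (Or.inr hcomm)
    fun g => subset_convexHull ℝ _
      ⟨ζ g x, hA.maps_states g x hx.1 hx.2, ζ g y, hA.maps_states g y hy.1 hy.2, by simp⟩
  have := hH hmem
  rwa [wernerProj, prodFunctional_tmul, hx.2, hy.2, mul_one, one_smul] at this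

/-- Dual counterpart of `wernerTensor_separable`: the projection of f ⊗ g. It supplies the optimal
separable effects in the plane. -/
theorem unit_add_mem_sepCone (hA : IsCompletelySymmetric A ζ)
    (hF : IsWernerFrame A ζ uS E Es) {f g : Dual ℝ V} (hf : f ∈ dualStateSet A uS)
    (hg : g ∈ dualStateSet A uS) :
    prodFunctional A.unit A.unit + (prodFunctional f g E / ((finrank ℝ V : ℝ) - 1)) • Es ∈
      sepCone A := by
  let H : Set (Dual ℝ (V ⊗[ℝ] V)) := convexHull ℝ
    (Set.image2 (fun a b => prodBilin V a b) (dualStateSet A uS) (dualStateSet A uS))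
  have hcl : @IsClosed _ (moduleTopology ℝ (Dual ℝ (V ⊗[ℝ] V))) H :=
    isClosed_convexHull_image2 (W := Dual ℝ V) (W₂ := Dual ℝ (V ⊗[ℝ] V))
      (isCompact_dualStateSet hA hF) (prodBilin V)
  have hH : H ⊆ sepCone A := by
    refine convexHull_min ?_ (PointedCone.convex_coe _)
    rintro _ ⟨a, ha, b, hb, rfl⟩
    change prodBilin V a b ∈ sepCone A
    rw [prodBilin_apply]
    exact prodFunctional_mem_sepCone ha.1 hb.1
  have hinv : ∀ g, ∀ f ∈ dualStateSet A uS, f ∘ₗ ζ g ∈ dualStateSet A uS := fun g f hf =>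
    ⟨hA.comp_mem_dualCone g hf.1, by simp [hF.invariant_uS, hf.2]⟩
  have h₁ : ∀ h, prodFunctional f g ∘ₗ TensorProduct.map (ζ h) (ζ h) ∈ H := fun h => by
    have : prodFunctional f g ∘ₗ TensorProduct.map (ζ h) (ζ h) =
        prodBilin V (f ∘ₗ ζ h) (g ∘ₗ ζ h) :=
      LinearMap.ext fun X => by rw [LinearMap.comp_apply, prodFunctional_map, prodBilin_apply]
    rw [this]
    exact subset_convexHull ℝ _ (Set.mem_image2_of_mem (hinv h f hf) (hinv h g hg))
  have h₂ : ∀ h, prodFunctional f g ∘ₗ (TensorProduct.comm ℝ V V).toLinearMap ∘ₗ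
      TensorProduct.map (ζ h) (ζ h) ∈ H := fun h => by
    have : prodFunctional f g ∘ₗ (TensorProduct.comm ℝ V V).toLinearMap ∘ₗ
        TensorProduct.map (ζ h) (ζ h) = prodBilin V (g ∘ₗ ζ h) (f ∘ₗ ζ h) :=
      LinearMap.ext fun X => by
        rw [LinearMap.comp_apply, LinearMap.comp_apply, LinearEquiv.coe_coe, prodFunctional_comm,
          prodFunctional_map, prodBilin_apply]
    rw [this]
    exact subset_convexHull ℝ _ (Set.mem_image2_of_mem (hinv h g hg) (hinv h f hf))
  have hmem := hH (dual_wernerProj_mem hA hF (convex_convexHull ℝ _) hcl h₁ h₂)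
  rwa [prodFunctional_tmul, hf.2, hg.2, mul_one, one_smul] at hmem

end Separable

/-! ### The parameters `m` -/

section Parameters

variable {V : Type*} [AddCommGroup V] [Module ℝ V]
variable {G : Type*} [Group G] {A : GPT V} {ζ : Representation ℝ G V}
variable {uS : V} {E : V ⊗[ℝ] V} {Es : Dual ℝ (V ⊗[ℝ] V)}

/-- Shifting by u_* does not change `Es`, so the maxima can be taken over the compact set of states.
In the `mMinus` version w = u_* - y produces the sign. -/
theorem mPlusSet_eq (hF : IsWernerFrame A ζ uS E Es) :
    mPlusSet A uS Es = {r | ∃ x ∈ stateSet A, r = TensorProduct.curry Es x x} := by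
  ext r
  constructor
  · rintro ⟨v, hv, hC, rfl⟩
    have hv : A.unit v = 0 := hv
    refine ⟨uS + v, ⟨hC, by simp [hF.unit_uS, hv]⟩, ?_⟩
    simp [tmul_add, hF.Es_left, hF.Es_right]
  · rintro ⟨x, ⟨hx, hx1⟩, rfl⟩
    refine ⟨x - uS, by simp [hx1, hF.unit_uS], by simpa using hx, ?_⟩
    simp [sub_tmul, tmul_sub, hF.Es_left, hF.Es_right]

theorem mMinusSet_eq (hF : IsWernerFrame A ζ uS E Es) :
    mMinusSet A uS Es =
      {r | ∃ x ∈ stateSet A, ∃ y ∈ stateSet A, r = -TensorProduct.curry Es x y} := by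
  ext r
  constructor
  · rintro ⟨v, hv, w, hw, hC, hC', rfl⟩
    have hv : A.unit v = 0 := hv
    have hw : A.unit w = 0 := hw
    refine ⟨uS + v, ⟨hC, by simp [hF.unit_uS, hv]⟩, uS - w, ⟨hC', by simp [hF.unit_uS, hw]⟩, ?_⟩
    simp [tmul_sub, hF.Es_left, hF.Es_right]
  · rintro ⟨x, ⟨hx, hx1⟩, y, ⟨hy, hy1⟩, rfl⟩
    refine ⟨x - uS, by simp [hx1, hF.unit_uS], uS - y, by simp [hy1, hF.unit_uS],
      by simpa using hx, by simpa using hy, ?_⟩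
    simp [sub_tmul, tmul_sub, hF.Es_left, hF.Es_right]

/-- The bilinear form on `V*` given by a tensor. -/
def tensorForm (X : V ⊗[ℝ] V) : Dual ℝ V →ₗ[ℝ] Dual ℝ V →ₗ[ℝ] ℝ :=
  (TensorProduct.mk ℝ (Dual ℝ V) (Dual ℝ V)).compr₂ ((dualDistrib ℝ V V).flip X)

theorem tensorForm_apply (X : V ⊗[ℝ] V) (f g : Dual ℝ V) :
    tensorForm X f g = prodFunctional f g X := rfl

theorem mStarPlusSet_eq (hF : IsWernerFrame A ζ uS E Es) :
    mStarPlusSet A uS E = {r | ∃ f ∈ dualStateSet A uS, r = tensorForm E f f} := by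
  have hl : ∀ f, tensorForm E A.unit f = 0 := hF.unit_left
  have hr : ∀ f, tensorForm E f A.unit = 0 := hF.unit_right
  ext r
  constructor
  · rintro ⟨f, hf, hC, rfl⟩
    refine ⟨A.unit + f, ⟨hC, by simp [hF.unit_uS, hf]⟩, ?_⟩
    change tensorForm E _ _ = _
    simp [hl, hr]
  · rintro ⟨f, ⟨hf, hf1⟩, rfl⟩
    refine ⟨f - A.unit, by simp [hf1, hF.unit_uS], by simpa using hf, ?_⟩
    simp [← tensorForm_apply, hl, hr]

theorem mStarMinusSet_eq (hF : IsWernerFrame A ζ uS E Es) :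
    mStarMinusSet A uS E =
      {r | ∃ f ∈ dualStateSet A uS, ∃ g ∈ dualStateSet A uS, r = -tensorForm E f g} := by
  have hl : ∀ f, tensorForm E A.unit f = 0 := hF.unit_left
  have hr : ∀ f, tensorForm E f A.unit = 0 := hF.unit_right
  ext r
  constructor
  · rintro ⟨f, g, hf, hg, hC, hC', rfl⟩
    refine ⟨A.unit + f, ⟨hC, by simp [hF.unit_uS, hf]⟩, A.unit - g,
      ⟨hC', by simp [hF.unit_uS, hg]⟩, ?_⟩
    change tensorForm E _ _ = _
    simp [hl, hr]
  · rintro ⟨f, ⟨hf, hf1⟩, g, ⟨hg, hg1⟩, rfl⟩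
    refine ⟨f - A.unit, A.unit - g, by simp [hf1, hF.unit_uS], by simp [hg1, hF.unit_uS],
      by simpa using hf, by simpa using hg, ?_⟩
    simp [← tensorForm_apply, hl, hr]

/-- For a positive semidefinite form, off-diagonal values are bounded by diagonal ones. -/
theorem abs_form_le {W : Type*} [AddCommGroup W] [Module ℝ W] (β : W →ₗ[ℝ] W →ₗ[ℝ] ℝ)
    (hsymm : ∀ v w, β v w = β w v) (hpos : ∀ v, 0 ≤ β v v) {S : Set W} {m : ℝ}
    (hm : ∀ x ∈ S, β x x ≤ m) {x y : W} (hx : x ∈ S) (hy : y ∈ S) : |β x y| ≤ m := by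
  -- Expanding β(x ± y, x ± y) ≥ 0 bounds ∓2β(x,y) by the two diagonal values.
  have h1 := hpos (x + y)
  have h2 := hpos (x - y)
  simp only [map_add, map_sub, LinearMap.add_apply, LinearMap.sub_apply, hsymm y x] at h1 h2
  have := hm x hx
  have := hm y hy
  rw [abs_le]
  constructor <;> linarith

end Parameters

/-! ### From normalised elements to cones -/

section Relations

variable {V : Type*} [AddCommGroup V] [Module ℝ V]
variable {G : Type*} [Group G] {A : GPT V} {ζ : Representation ℝ G V}
variable {uS : V} {E : V ⊗[ℝ] V} {Es : Dual ℝ (V ⊗[ℝ] V)}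

theorem prodFunctional_wernerTensor {f g : Dual ℝ V} (hf : f ∈ dualStateSet A uS)
    (hg : g ∈ dualStateSet A uS) (φ : ℝ) :
    prodFunctional f g (wernerTensor uS E φ) = 1 + φ * prodFunctional f g E := by
  simp [wernerTensor, prodFunctional_tmul, hf.2, hg.2]

theorem one_add_nonneg_of_mem_max {φ : ℝ}
    (h : wernerTensor uS E φ ∈ PointedCone.maxTensorProduct A.cone A.cone) {f g : Dual ℝ V}
    (hf : f ∈ dualStateSet A uS) (hg : g ∈ dualStateSet A uS) :
    0 ≤ 1 + φ * prodFunctional f g E := by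
  rw [← prodFunctional_wernerTensor hf hg]
  exact PointedCone.mem_maxTensorProduct.1 h f hf.1 g hg.1

theorem unit_mem_dualStateSet [FiniteDimensional ℝ V] (hF : IsWernerFrame A ζ uS E Es) :
    A.unit ∈ dualStateSet A uS :=
  ⟨fun _ hx => A.unit_nonneg hx, hF.unit_uS⟩

theorem convex_wernerTensor {D : Set (V ⊗[ℝ] V)} (hD : Convex ℝ D) :
    Convex ℝ {φ | wernerTensor uS E φ ∈ D} := by
  intro φ hφ ψ hψ a b ha hb hab
  have : wernerTensor uS E (a • φ + b • ψ) =
      a • wernerTensor uS E φ + b • wernerTensor uS E ψ := by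
    calc wernerTensor uS E (a • φ + b • ψ)
        = (a + b) • (uS ⊗ₜ[ℝ] uS) + (a • φ + b • ψ) • E := by rw [hab, one_smul, wernerTensor]
      _ = _ := by
        simp only [wernerTensor]
        module
  change wernerTensor uS E (a • φ + b • ψ) ∈ D
  rw [this]
  exact hD hφ hψ ha hb hab

/-- Inequalities for a form on states extend to the minimal tensor product. -/
theorem min_nonneg_of_states [FiniteDimensional ℝ V] {F : Dual ℝ (V ⊗[ℝ] V)}
    (h : ∀ x ∈ stateSet A, ∀ y ∈ stateSet A, 0 ≤ F (x ⊗ₜ y)) {X : V ⊗[ℝ] V}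
    (hX : X ∈ PointedCone.minTensorProduct A.cone A.cone) : 0 ≤ F X := by
  refine minTensorProduct_nonneg (fun x hx y hy => ?_) hX
  rcases eq_or_ne x 0 with rfl | hx0
  · simp
  rcases eq_or_ne y 0 with rfl | hy0
  · simp
  have hpx := A.unit_pos hx hx0
  have hpy := A.unit_pos hy hy0
  have := h ((A.unit x)⁻¹ • x) ⟨A.smul_mem_cone (inv_nonneg.2 hpx.le) hx, by simp [hpx.ne']⟩
    ((A.unit y)⁻¹ • y) ⟨A.smul_mem_cone (inv_nonneg.2 hpy.le) hy, by simp [hpy.ne']⟩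
  rw [← smul_tmul', tmul_smul, map_smul, map_smul, smul_eq_mul, smul_eq_mul] at this
  exact nonneg_of_mul_nonneg_right
    (nonneg_of_mul_nonneg_right this (inv_pos.2 hpx)) (inv_pos.2 hpy)

/-- Inequalities for a tensor on normalised functionals extend to separable functionals. -/
theorem sep_nonneg_of_dualStates [FiniteDimensional ℝ V] [TopologicalSpace G]
    [IsTopologicalGroup G] [CompactSpace G] (hA : IsCompletelySymmetric A ζ)
    (hF : IsWernerFrame A ζ uS E Es) {X : V ⊗[ℝ] V}
    (h : ∀ f ∈ dualStateSet A uS, ∀ g ∈ dualStateSet A uS, 0 ≤ prodFunctional f g X)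
    {F : Dual ℝ (V ⊗[ℝ] V)} (hFs : F ∈ sepCone A) : 0 ≤ F X := by
  refine sepCone_nonneg (fun f hf g hg => ?_) hFs
  rcases eq_or_ne f 0 with rfl | hf0
  · simp [prodFunctional]
  rcases eq_or_ne g 0 with rfl | hg0
  · simp [prodFunctional]
  have hpf := apply_uS_pos hA hF hf hf0
  have hpg := apply_uS_pos hA hF hg hg0
  have := h ((f uS)⁻¹ • f) ⟨A.smul_mem_dualCone (inv_nonneg.2 hpf.le) hf, by simp [hpf.ne']⟩
    ((g uS)⁻¹ • g) ⟨A.smul_mem_dualCone (inv_nonneg.2 hpg.le) hg, by simp [hpg.ne']⟩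
  rw [prodFunctional_smul_left, prodFunctional_smul_right, LinearMap.smul_apply,
    LinearMap.smul_apply, smul_eq_mul, smul_eq_mul] at this
  exact nonneg_of_mul_nonneg_right
    (nonneg_of_mul_nonneg_right this (inv_pos.2 hpf)) (inv_pos.2 hpg)

end Relations

/-! ### Existence and inequalities of the parameters m, and separability of χ_φ -/

section Parameters

variable {V : Type*} [AddCommGroup V] [Module ℝ V] [FiniteDimensional ℝ V]
variable {G : Type*} [Group G] {A : GPT V} {ζ : Representation ℝ G V}
variable {uS : V} {E : V ⊗[ℝ] V} {Es : Dual ℝ (V ⊗[ℝ] V)} {mp mm msp msm : ℝ}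

theorem IsWernerFrame.Es_nonneg (hF : IsWernerFrame A ζ uS E Es) (v : V) :
    0 ≤ TensorProduct.curry Es v v := by
  have h : TensorProduct.curry Es v v =
      Es ((v - A.unit v • uS) ⊗ₜ (v - A.unit v • uS)) := by
    simp [sub_tmul, tmul_sub, ← smul_tmul', hF.Es_left, hF.Es_right]
  rw [h]
  rcases eq_or_ne (v - A.unit v • uS) 0 with h0 | h0
  · simp [h0]
  · exact (hF.Es_pos (by simp [hF.unit_uS]) h0).le

omit [FiniteDimensional ℝ V] in
theorem IsWernerFrame.E_nonneg (hF : IsWernerFrame A ζ uS E Es) (f : Dual ℝ V) :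
    0 ≤ tensorForm E f f := by
  have hl : ∀ f, tensorForm E A.unit f = 0 := hF.unit_left
  have hr : ∀ f, tensorForm E f A.unit = 0 := hF.unit_right
  have h : tensorForm E f f = tensorForm E (f - f uS • A.unit) (f - f uS • A.unit) := by
    simp [hl, hr]
  rw [h]
  rcases eq_or_ne (f - f uS • A.unit) 0 with h0 | h0
  · simp [h0]
  · exact (hF.pos_E _ (by simp [hF.unit_uS]) h0).le

theorem form_le_mPlus (hF : IsWernerFrame A ζ uS E Es) (hmp : IsGreatest (mPlusSet A uS Es) mp)
    {x y : V} (hx : x ∈ stateSet A) (hy : y ∈ stateSet A) : |Es (x ⊗ₜ y)| ≤ mp := by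
  rw [mPlusSet_eq hF] at hmp
  exact abs_form_le (TensorProduct.curry Es) hF.Es_symm hF.Es_nonneg
    (fun x hx => hmp.2 ⟨x, hx, rfl⟩) hx hy

omit [FiniteDimensional ℝ V] in
theorem neg_mMinus_le_form (hF : IsWernerFrame A ζ uS E Es)
    (hmm : IsGreatest (mMinusSet A uS Es) mm)
    {x y : V} (hx : x ∈ stateSet A) (hy : y ∈ stateSet A) : -mm ≤ Es (x ⊗ₜ y) := by
  rw [mMinusSet_eq hF] at hmm
  exact neg_le.1 (hmm.2 ⟨x, hx, y, hy, rfl⟩)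

theorem mMinus_le_mPlus (hF : IsWernerFrame A ζ uS E Es)
    (hmp : IsGreatest (mPlusSet A uS Es) mp) (hmm : IsGreatest (mMinusSet A uS Es) mm) :
    mm ≤ mp := by
  rw [mMinusSet_eq hF] at hmm
  obtain ⟨x, hx, y, hy, rfl⟩ := hmm.1
  exact (neg_le_abs _).trans (form_le_mPlus hF hmp hx hy)

omit [FiniteDimensional ℝ V] in
theorem form_le_mStarPlus (hF : IsWernerFrame A ζ uS E Es)
    (hmsp : IsGreatest (mStarPlusSet A uS E) msp) {f g : Dual ℝ V} (hf : f ∈ dualStateSet A uS)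
    (hg : g ∈ dualStateSet A uS) : |prodFunctional f g E| ≤ msp := by
  rw [mStarPlusSet_eq hF] at hmsp
  exact abs_form_le (tensorForm E) hF.symm_apply hF.E_nonneg
    (fun x hx => hmsp.2 ⟨x, hx, rfl⟩) hf hg

omit [FiniteDimensional ℝ V] in
theorem neg_mStarMinus_le_form (hF : IsWernerFrame A ζ uS E Es)
    (hmsm : IsGreatest (mStarMinusSet A uS E) msm) {f g : Dual ℝ V}
    (hf : f ∈ dualStateSet A uS) (hg : g ∈ dualStateSet A uS) :
    -msm ≤ prodFunctional f g E := by
  rw [mStarMinusSet_eq hF] at hmsm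
  exact neg_le.1 (hmsm.2 ⟨f, hf, g, hg, rfl⟩)

omit [FiniteDimensional ℝ V] in
theorem mStarMinus_le_mStarPlus (hF : IsWernerFrame A ζ uS E Es)
    (hmsp : IsGreatest (mStarPlusSet A uS E) msp)
    (hmsm : IsGreatest (mStarMinusSet A uS E) msm) : msm ≤ msp := by
  rw [mStarMinusSet_eq hF] at hmsm
  obtain ⟨f, hf, g, hg, rfl⟩ := hmsm.1
  exact (neg_le_abs _).trans (form_le_mStarPlus hF hmsp hf hg)

theorem unit_add_curry_mem (hF : IsWernerFrame A ζ uS E Es) {x : V} {c : ℝ}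
    (h : ∀ y ∈ stateSet A, 0 ≤ 1 + c * Es (x ⊗ₜ y)) :
    A.unit + c • TensorProduct.curry Es x ∈ dualStateSet A uS := by
  refine ⟨fun y hy => ?_, by simp [hF.unit_uS, hF.Es_right]⟩
  rcases eq_or_ne y 0 with rfl | hy0
  · simp
  have hp := A.unit_pos hy hy0
  have := mul_nonneg hp.le (h ((A.unit y)⁻¹ • y)
    ⟨A.smul_mem_cone (inv_nonneg.2 hp.le) hy, by simp [hp.ne']⟩)
  have e : A.unit y * (1 + c * Es (x ⊗ₜ[ℝ] ((A.unit y)⁻¹ • y))) =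
      (A.unit + c • TensorProduct.curry Es x) y := by
    simp
    field_simp
  rwa [e] at this

theorem tensorForm_unit_add_curry (hF : IsWernerFrame A ζ uS E Es) (x : V) (a b : ℝ) :
    tensorForm E (A.unit + a • TensorProduct.curry Es x) (A.unit + b • TensorProduct.curry Es x) =
      a * b * Es (x ⊗ₜ x) := by
  have hl : ∀ f, tensorForm E A.unit f = 0 := hF.unit_left
  have hr : ∀ f, tensorForm E f A.unit = 0 := hF.unit_right
  have h : tensorForm E (TensorProduct.curry Es x) (TensorProduct.curry Es x) = Es (x ⊗ₜ x) := by
    rw [tensorForm_apply, ← apply_tensorMap, hF.tensorMap_curry]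
    simp [tmul_sub, hF.Es_right]
  simp [hl, hr, h]
  ring

variable [TopologicalSpace G]

/-- If u_* were the only state, the cone would lie on a line and V₀ would vanish. -/
theorem exists_state_ne (hA : IsCompletelySymmetric A ζ) (uS : V) :
    ∃ x ∈ stateSet A, x ≠ uS := by
  by_contra! h
  have h1 : (LinearMap.id : V →ₗ[ℝ] V) = A.unit.smulRight uS := A.ext_cone fun x hx => by
    rcases eq_or_ne x 0 with rfl | hx0
    · simp
    have hp := A.unit_pos hx hx0
    have := h ((A.unit x)⁻¹ • x) ⟨A.smul_mem_cone (inv_nonneg.2 hp.le) hx, by simp [hp.ne']⟩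
    simp [← this, hp.ne']
  obtain ⟨g, x, hx, hne⟩ := hA.nontrivial
  have hx : A.unit x = 0 := hx
  have h0 : x = 0 := by simpa [hx] using LinearMap.congr_fun h1 x
  simp [h0] at hne

theorem finrank_sub_one_pos (hA : IsCompletelySymmetric A ζ) : 0 < (finrank ℝ V : ℝ) - 1 := by
  have : (1 : ℝ) < finrank ℝ V := by exact_mod_cast hA.one_lt_finrank
  linarith

variable [IsTopologicalGroup G] [CompactSpace G]

/-- If m_- ≤ 0, then E_*(x, ·) is in the dual cone for each state x; as it vanishes at u_*, it is
zero by `apply_uS_pos`. A state x ≠ u_* contradicts definiteness of E_* on V₀. -/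
theorem mMinus_pos (hA : IsCompletelySymmetric A ζ) (hF : IsWernerFrame A ζ uS E Es)
    (hmm : IsGreatest (mMinusSet A uS Es) mm) : 0 < mm := by
  by_contra! hle
  obtain ⟨x, hx, hne⟩ := exists_state_ne hA uS
  have hd : TensorProduct.curry Es x ∈ A.dualCone := fun y hy => by
    have := min_nonneg_of_states (F := Es)
      (fun x hx y hy => by linarith [neg_mMinus_le_form hF hmm hx hy])
      (PointedCone.tmul_mem_minTensorProduct hx.1 hy)
    exact this
  have h0 : TensorProduct.curry Es x = 0 := by
    by_contra hn
    exact (apply_uS_pos hA hF hd hn).ne' (hF.Es_right x)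
  have h1 : Es ((x - uS) ⊗ₜ (x - uS)) = TensorProduct.curry Es x x := by
    simp [sub_tmul, tmul_sub, hF.Es_left, hF.Es_right]
  have := hF.Es_pos (v := x - uS) (by simp [hx.2, hF.unit_uS]) (sub_ne_zero.2 hne)
  rw [h1, h0] at this
  simp at this

theorem exists_m_parameters (hA : IsCompletelySymmetric A ζ) (hF : IsWernerFrame A ζ uS E Es) :
    ∃ mp mm msp msm : ℝ, IsGreatest (mPlusSet A uS Es) mp ∧ IsGreatest (mMinusSet A uS Es) mm ∧
      IsGreatest (mStarPlusSet A uS E) msp ∧ IsGreatest (mStarMinusSet A uS E) msm := by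
  have hne : (stateSet A).Nonempty := ⟨uS, uS_mem_cone hA hF, hF.unit_uS⟩
  have hne' : (dualStateSet A uS).Nonempty := ⟨_, unit_mem_dualStateSet hF⟩
  rw [mPlusSet_eq hF, mMinusSet_eq hF, mStarPlusSet_eq hF, mStarMinusSet_eq hF]
  obtain ⟨mp, hmp⟩ := exists_isGreatest_diagonal A.isCompact_states hne (TensorProduct.curry Es)
  obtain ⟨mm, hmm⟩ := exists_isGreatest_bilinear A.isCompact_states hne (-TensorProduct.curry Es)
  obtain ⟨msp, hmsp⟩ := exists_isGreatest_diagonal (W := Dual ℝ V)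
    (isCompact_dualStateSet hA hF) hne' (tensorForm E)
  obtain ⟨msm, hmsm⟩ := exists_isGreatest_bilinear (W := Dual ℝ V)
    (isCompact_dualStateSet hA hF) hne' (-tensorForm E)
  exact ⟨mp, mm, msp, msm, hmp, hmm, hmsp, hmsm⟩

theorem one_le_mPlus_mul_mStarMinus (hA : IsCompletelySymmetric A ζ) (hF : IsWernerFrame A ζ uS E Es)
    (hmp : IsGreatest (mPlusSet A uS Es) mp) (hmm : IsGreatest (mMinusSet A uS Es) mm)
    (hmsp : IsGreatest (mStarPlusSet A uS E) msp)
    (hmsm : IsGreatest (mStarMinusSet A uS E) msm) : 1 ≤ mp * msm ∧ 1 ≤ mm * msp := by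
  have hm := mMinus_pos hA hF hmm
  have hle := mMinus_le_mPlus hF hmp hmm
  have hp : 0 < mp := hm.trans_le hle
  obtain ⟨x, hx, hmx⟩ : ∃ x ∈ stateSet A, mp = Es (x ⊗ₜ x) := by
    have := hmp.1
    rw [mPlusSet_eq hF] at this
    exact this
  -- The coefficients 1/m_- and -1/m_+ are the largest ones for which the bounds -m_- ≤ E_* ≤ m_+ on
  -- states guarantee positivity.
  have h1 : A.unit + (1 / mm) • TensorProduct.curry Es x ∈ dualStateSet A uS :=
    unit_add_curry_mem hF fun y hy => by
      have := neg_mMinus_le_form hF hmm hx hy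
      field_simp
      linarith
  have h2 : A.unit + (-(1 / mp)) • TensorProduct.curry Es x ∈ dualStateSet A uS :=
    unit_add_curry_mem hF fun y hy => by
      have := (abs_le.1 (form_le_mPlus hF hmp hx hy)).2
      field_simp
      linarith
  have b1 := neg_mStarMinus_le_form hF hmsm h1 h2
  have b2 := (abs_le.1 (form_le_mStarPlus hF hmsp h1 h1)).2
  rw [← tensorForm_apply, tensorForm_unit_add_curry hF, ← hmx] at b1 b2
  have e1 : 1 / mm * -(1 / mp) * mp = -(1 / mm) := by field_simp
  have e2 : 1 / mm * (1 / mm) * mp = mp / mm / mm := by field_simp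
  rw [e1, neg_le_neg_iff, div_le_iff₀ hm] at b1
  rw [e2, div_le_iff₀ hm] at b2
  have b3 : 1 ≤ mp / mm := (one_le_div hm).2 hle
  have hmsm0 : 0 < msm := pos_of_mul_pos_left (one_pos.trans_le b1) hm.le
  constructor
  · nlinarith
  · linarith

theorem wernerTensor_mPlus_mem (hA : IsCompletelySymmetric A ζ)
    (hF : IsWernerFrame A ζ uS E Es) (hmp : IsGreatest (mPlusSet A uS Es) mp) :
    wernerTensor uS E (mp / ((finrank ℝ V : ℝ) - 1)) ∈
      PointedCone.minTensorProduct A.cone A.cone := by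
  rw [mPlusSet_eq hF] at hmp
  obtain ⟨x, hx, rfl⟩ := hmp.1
  exact wernerTensor_separable hA hF hx hx

theorem wernerTensor_mMinus_mem (hA : IsCompletelySymmetric A ζ)
    (hF : IsWernerFrame A ζ uS E Es) (hmm : IsGreatest (mMinusSet A uS Es) mm) :
    wernerTensor uS E (-(mm / ((finrank ℝ V : ℝ) - 1))) ∈
      PointedCone.minTensorProduct A.cone A.cone := by
  rw [mMinusSet_eq hF] at hmm
  obtain ⟨x, hx, y, hy, rfl⟩ := hmm.1
  rw [← neg_div, neg_neg]
  exact wernerTensor_separable hA hF hx hy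

theorem wernerTensor_mem_min_iff (hA : IsCompletelySymmetric A ζ)
    (hF : IsWernerFrame A ζ uS E Es) (hmp : IsGreatest (mPlusSet A uS Es) mp)
    (hmm : IsGreatest (mMinusSet A uS Es) mm) (φ : ℝ) :
    wernerTensor uS E φ ∈ PointedCone.minTensorProduct A.cone A.cone ↔
      -(mm / ((finrank ℝ V : ℝ) - 1)) ≤ φ ∧ φ ≤ mp / ((finrank ℝ V : ℝ) - 1) := by
  have hd := finrank_sub_one_pos hA
  constructor
  · intro h
    have hU : prodFunctional A.unit A.unit (wernerTensor uS E φ) = 1 := by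
      rw [prodFunctional_wernerTensor (unit_mem_dualStateSet hF) (unit_mem_dualStateSet hF),
        hF.unit_left]
      simp
    have hE : Es (wernerTensor uS E φ) = φ * ((finrank ℝ V : ℝ) - 1) := by
      simp [wernerTensor, hF.Es_left, hF.Es_E]
    -- The functionals m_+ U - E_* and m_- U + E_* are nonnegative on product states, hence on
    -- separable tensors.
    have b1 := min_nonneg_of_states (F := mp • prodFunctional A.unit A.unit - Es)
      (fun x hx y hy => by
        have := (abs_le.1 (form_le_mPlus hF hmp hx hy)).2
        simpa [prodFunctional_tmul, hx.2, hy.2] using this) h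
    have b2 := min_nonneg_of_states (F := mm • prodFunctional A.unit A.unit + Es)
      (fun x hx y hy => by
        have := neg_mMinus_le_form hF hmm hx hy
        simp only [LinearMap.add_apply, LinearMap.smul_apply, prodFunctional_tmul, hx.2, hy.2,
          smul_eq_mul]
        linarith) h
    simp only [LinearMap.add_apply, LinearMap.sub_apply, LinearMap.smul_apply, hU, hE,
      smul_eq_mul] at b1 b2
    rw [← neg_div, div_le_iff₀ hd, le_div_iff₀ hd]
    constructor <;> linarith
  · rintro ⟨h1, h2⟩
    exact (convex_wernerTensor (PointedCone.convex_coe _)).ordConnected.out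
      (wernerTensor_mMinus_mem hA hF hmm) (wernerTensor_mPlus_mem hA hF hmp) ⟨h1, h2⟩

/-- The extremal separable χ_φ are nonnegative on the product functionals that attain m_-^* and
m_+^*. -/
theorem mPlus_mul_mStarMinus_le (hA : IsCompletelySymmetric A ζ) (hF : IsWernerFrame A ζ uS E Es)
    (hmp : IsGreatest (mPlusSet A uS Es) mp) (hmm : IsGreatest (mMinusSet A uS Es) mm)
    (hmsp : IsGreatest (mStarPlusSet A uS E) msp)
    (hmsm : IsGreatest (mStarMinusSet A uS E) msm) :
    mp * msm ≤ (finrank ℝ V : ℝ) - 1 ∧ mm * msp ≤ (finrank ℝ V : ℝ) - 1 := by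
  have hd := finrank_sub_one_pos hA
  have hmax := PointedCone.minTensorProduct_le_maxTensorProduct A.cone A.cone
  rw [mStarPlusSet_eq hF] at hmsp
  rw [mStarMinusSet_eq hF] at hmsm
  obtain ⟨f, hf, hfe⟩ := hmsp.1
  obtain ⟨g, hg, h, hh, hgh⟩ := hmsm.1
  have b1 := one_add_nonneg_of_mem_max (hmax (wernerTensor_mPlus_mem hA hF hmp)) hg hh
  have b2 := one_add_nonneg_of_mem_max (hmax (wernerTensor_mMinus_mem hA hF hmm)) hf hf
  rw [← tensorForm_apply, ← neg_eq_iff_eq_neg.2 hgh] at b1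
  rw [← tensorForm_apply, ← hfe] at b2
  constructor
  · have : mp / ((finrank ℝ V : ℝ) - 1) * msm ≤ 1 := by linarith
    rwa [div_mul_eq_mul_div, div_le_one hd] at this
  · have : mm / ((finrank ℝ V : ℝ) - 1) * msp ≤ 1 := by linarith
    rwa [div_mul_eq_mul_div, div_le_one hd] at this

end Parameters

/-! ### Norms -/

section Norms

variable {W : Type*} [AddCommGroup W] [Module ℝ W] {B : GPT W}

/-- The two sets of values dominate each other: a measurement yields f = ∑ sign(eᵢ x) eᵢ, and f
yields the binary measurement (u ± f)/2. -/
theorem GPT.distNorm_univ (B : GPT W) (x : W) : B.distNorm Set.univ x = B.baseNorm x := by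
  refine csSup_eq_csSup_of_forall_exists_le ?_ ?_
  · rintro _ ⟨μ, -, rfl⟩
    let ε : Fin μ.outcomes → ℝ := fun i => SignType.sign (μ.effect i x)
    have hε : ∀ i, 0 ≤ 1 + ε i ∧ 0 ≤ 1 - ε i := fun i => by
      simp only [ε]
      rcases SignType.sign (μ.effect i x) with _ | _ | _ <;> norm_num
    refine ⟨(∑ i, ε i • μ.effect i) x, ⟨_, ?_, ?_, rfl⟩, ?_⟩
    · rw [← μ.sum_effect, ← Finset.sum_add_distrib]
      refine Submodule.sum_mem _ fun i _ => ?_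
      have : μ.effect i + ε i • μ.effect i = (1 + ε i) • μ.effect i := by module
      rw [this]
      exact B.smul_mem_dualCone (hε i).1 (μ.mem_effects i).1
    · rw [← μ.sum_effect, ← Finset.sum_sub_distrib]
      refine Submodule.sum_mem _ fun i _ => ?_
      have : μ.effect i - ε i • μ.effect i = (1 - ε i) • μ.effect i := by module
      rw [this]
      exact B.smul_mem_dualCone (hε i).2 (μ.mem_effects i).1
    · simp only [LinearMap.sum_apply, LinearMap.smul_apply, smul_eq_mul, ε]
      exact (Finset.sum_congr rfl fun i _ => (sign_mul_self _).symm).le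
  · rintro _ ⟨f, h1, h2, rfl⟩
    have e1 : (1 / 2 : ℝ) • (B.unit + f) ∈ B.dualCone := B.smul_mem_dualCone (by norm_num) h1
    have e2 : (1 / 2 : ℝ) • (B.unit - f) ∈ B.dualCone := B.smul_mem_dualCone (by norm_num) h2
    have hs : (1 / 2 : ℝ) • (B.unit + f) + (1 / 2 : ℝ) • (B.unit - f) = B.unit := by module
    refine ⟨_, ⟨⟨2, ![(1 / 2 : ℝ) • (B.unit + f), (1 / 2 : ℝ) • (B.unit - f)], fun i => ?_, ?_⟩,
      trivial, rfl⟩, ?_⟩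
    · fin_cases i
      · refine ⟨e1, ?_⟩
        change B.unit - (1 / 2 : ℝ) • (B.unit + f) ∈ B.dualCone
        rwa [← eq_sub_iff_add_eq'.2 hs]
      · refine ⟨e2, ?_⟩
        change B.unit - (1 / 2 : ℝ) • (B.unit - f) ∈ B.dualCone
        rwa [← eq_sub_iff_add_eq.2 hs]
    · simpa using hs
    · simp only [Fin.sum_univ_two, Matrix.cons_val_zero, Matrix.cons_val_one,
        LinearMap.smul_apply, LinearMap.add_apply, LinearMap.sub_apply, smul_eq_mul]
      have := le_abs_self (1 / 2 * (B.unit x + f x))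
      have := neg_abs_le (1 / 2 * (B.unit x - f x))
      linarith

/-- The distinguishability norm on a plane that is spanned by the vertices of the sections of a
cone and of its dual. -/
theorem GPT.distNorm_eq_of_vertices {M : Set B.Measurement} {K : PointedCone ℝ (Dual ℝ W)}
    (hM : ∀ μ, μ ∈ M ↔ ∀ i, μ.effect i ∈ K) (hK : K ≤ B.dualCone) {w₁ w₂ : W}
    (h₁ : ∀ F ∈ K, 0 ≤ F w₁) (h₂ : ∀ F ∈ K, 0 ≤ F w₂) {e₁ e₂ : Dual ℝ W} (he₁ : e₁ ∈ K)
    (he₂ : e₂ ∈ K) (hsum : e₁ + e₂ = B.unit) (h11 : e₁ w₁ = 1) (h12 : e₁ w₂ = 0)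
    (h21 : e₂ w₁ = 0) (h22 : e₂ w₂ = 1) (s t : ℝ) :
    B.distNorm M (s • w₁ + t • w₂) = |s| + |t| := by
  refine IsGreatest.csSup_eq ⟨?_, ?_⟩
  · refine ⟨⟨2, ![e₁, e₂], fun i => ?_, by simpa using hsum⟩, (hM _).2 fun i => ?_, ?_⟩
    · fin_cases i
      · exact ⟨hK he₁, by simpa [← hsum] using hK he₂⟩
      · exact ⟨hK he₂, by simpa [← hsum] using hK he₁⟩
    · fin_cases i
      · exact he₁
      · exact he₂
    · simp [h11, h12, h21, h22]
  · rintro _ ⟨μ, hμ, rfl⟩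
    have hμ := (hM μ).1 hμ
    have hu1 : ∑ i, μ.effect i w₁ = 1 := by
      rw [← LinearMap.sum_apply, μ.sum_effect, ← hsum, LinearMap.add_apply, h11, h21, add_zero]
    have hu2 : ∑ i, μ.effect i w₂ = 1 := by
      rw [← LinearMap.sum_apply, μ.sum_effect, ← hsum, LinearMap.add_apply, h12, h22, zero_add]
    calc ∑ i, |μ.effect i (s • w₁ + t • w₂)|
        ≤ ∑ i, (|s| * μ.effect i w₁ + |t| * μ.effect i w₂) := by
          refine Finset.sum_le_sum fun i _ => ?_
          rw [map_add, map_smul, map_smul]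
          refine (abs_add_le _ _).trans_eq ?_
          rw [smul_eq_mul, smul_eq_mul, abs_mul, abs_mul, abs_of_nonneg (h₁ _ (hμ i)),
            abs_of_nonneg (h₂ _ (hμ i))]
      _ = |s| + |t| := by
          rw [Finset.sum_add_distrib, ← Finset.mul_sum, ← Finset.mul_sum, hu1, hu2, mul_one,
            mul_one]

end Norms

/-! ### The norm of the plane of Werner tensors -/

section Plane

/-- The norm on the plane whose unit ball has the vertices `±(1, p)` and `±(1, -m)`. -/
noncomputable def planeNorm (p m a b : ℝ) : ℝ := |(a * m + b) / (p + m)| + |(a * p - b) / (p + m)|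

variable {p m p' m' : ℝ}

theorem planeNorm_pos (hp : 0 < p) (hm : 0 < m) {a b : ℝ} (h : (a, b) ≠ (0, 0)) :
    0 < planeNorm p m a b := by
  by_contra! hle
  have h1 : (a * m + b) / (p + m) = 0 := by
    rw [← abs_eq_zero]
    exact le_antisymm ((le_add_of_nonneg_right (abs_nonneg _)).trans hle) (abs_nonneg _)
  have h2 : (a * p - b) / (p + m) = 0 := by
    rw [← abs_eq_zero]
    exact le_antisymm ((le_add_of_nonneg_left (abs_nonneg _)).trans hle) (abs_nonneg _)
  have hpm : p + m ≠ 0 := by positivity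
  have h3 := (div_eq_zero_iff.1 h1).resolve_right hpm
  have h4 := (div_eq_zero_iff.1 h2).resolve_right hpm
  have h5 : a * (p + m) = 0 := by linarith
  have ha : a = 0 := (mul_eq_zero.1 h5).resolve_right hpm
  subst ha
  exact h (by simpa using h3)

/-- A convex function on a parallelogram is largest at a vertex. Here s and t are the coordinates of
(a, b) with respect to the vertices (1, p') and (1, -m') of the larger ball. -/
theorem planeNorm_le (hp : 0 < p) (hm : 0 < m) (hpp : p ≤ p') (hmm : m ≤ m') (a b : ℝ) :
    planeNorm p m a b ≤
      (1 + 2 / (p + m) * max (m' - m) (p' - p)) * planeNorm p' m' a b := by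
  have hpm : 0 < p + m := by positivity
  have hpm' : 0 < p' + m' := by linarith
  set s := (a * m' + b) / (p' + m') with hs
  set t := (a * p' - b) / (p' + m') with ht
  have e1 : a * m + b = s * (m + p') - t * (m' - m) := by
    rw [hs, ht]
    field_simp
    ring
  have e2 : a * p - b = t * (p + m') - s * (p' - p) := by
    rw [hs, ht]
    field_simp
    ring
  have b1 : |a * m + b| ≤ |s| * (m + p') + |t| * (m' - m) := by
    rw [e1]
    refine (abs_sub _ _).trans_eq ?_
    rw [abs_mul, abs_mul, abs_of_nonneg (by linarith : 0 ≤ m + p'),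
      abs_of_nonneg (sub_nonneg.2 hmm)]
  have b2 : |a * p - b| ≤ |t| * (p + m') + |s| * (p' - p) := by
    rw [e2]
    refine (abs_sub _ _).trans_eq ?_
    rw [abs_mul, abs_mul, abs_of_nonneg (by linarith : 0 ≤ p + m'),
      abs_of_nonneg (sub_nonneg.2 hpp)]
  have c1 : |s| * (p' - p) ≤ |s| * max (m' - m) (p' - p) :=
    mul_le_mul_of_nonneg_left (le_max_right _ _) (abs_nonneg _)
  have c2 : |t| * (m' - m) ≤ |t| * max (m' - m) (p' - p) :=
    mul_le_mul_of_nonneg_left (le_max_left _ _) (abs_nonneg _)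
  rw [planeNorm, planeNorm, abs_div, abs_div, abs_of_pos hpm, ← add_div, div_le_iff₀ hpm, ← hs,
    ← ht]
  have e3 : (1 + 2 / (p + m) * max (m' - m) (p' - p)) * (|s| + |t|) * (p + m) =
      (p + m + 2 * max (m' - m) (p' - p)) * (|s| + |t|) := by
    field_simp
  rw [e3]
  linarith

theorem planeNorm_upper (hp : 0 < p) (hm : 0 < m) (hpp : p ≤ p') :
    planeNorm p m 1 p' = 1 + 2 / (p + m) * (p' - p) := by
  have hpm : 0 < p + m := by positivity
  rw [planeNorm, abs_of_nonneg (div_nonneg (by linarith) hpm.le),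
    abs_of_nonpos (div_nonpos_of_nonpos_of_nonneg (by linarith) hpm.le)]
  field_simp
  ring

theorem planeNorm_lower (hp : 0 < p) (hm : 0 < m) (hmm : m ≤ m') :
    planeNorm p m 1 (-m') = 1 + 2 / (p + m) * (m' - m) := by
  have hpm : 0 < p + m := by positivity
  rw [planeNorm, abs_of_nonpos (div_nonpos_of_nonpos_of_nonneg (by linarith) hpm.le),
    abs_of_nonneg (div_nonneg (by linarith) hpm.le)]
  field_simp
  ring

theorem planeNorm_smul {c : ℝ} (hc : 0 ≤ c) (a b : ℝ) :
    planeNorm p m (c * a) (c * b) = c * planeNorm p m a b := by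
  rw [planeNorm, planeNorm]
  have e1 : (c * a * m + c * b) / (p + m) = c * ((a * m + b) / (p + m)) := by ring
  have e2 : (c * a * p - c * b) / (p + m) = c * ((a * p - b) / (p + m)) := by ring
  rw [e1, e2, abs_mul, abs_mul, abs_of_nonneg hc]
  ring

end Plane

/-! ### Norms of Werner tensors -/

section WernerNorms

variable {V : Type*} [AddCommGroup V] [Module ℝ V]

theorem eq_combination_wernerTensor {uS : V} {E : V ⊗[ℝ] V} {p m : ℝ} (hpm : p + m ≠ 0)
    (a b : ℝ) : a • (uS ⊗ₜ[ℝ] uS) + b • E =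
      ((a * m + b) / (p + m)) • wernerTensor uS E p +
        ((a * p - b) / (p + m)) • wernerTensor uS E (-m) := by
  have h1 : (a * m + b) / (p + m) + (a * p - b) / (p + m) = a := by
    field_simp
    ring
  have h2 : (a * m + b) / (p + m) * p + (a * p - b) / (p + m) * -m = b := by
    field_simp
    ring
  conv_lhs => rw [← h1, ← h2]
  simp only [wernerTensor]
  module

variable [FiniteDimensional ℝ V]
variable {G : Type*} [Group G] [TopologicalSpace G] {A : GPT V} {ζ : Representation ℝ G V}
variable {uS : V} {E : V ⊗[ℝ] V} {Es : Dual ℝ (V ⊗[ℝ] V)} {AB : GPT (V ⊗[ℝ] V)}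

omit [TopologicalSpace G] in
theorem unit_wernerTensor (hF : IsWernerFrame A ζ uS E Es) (φ : ℝ) :
    prodFunctional A.unit A.unit (wernerTensor uS E φ) = 1 := by
  rw [prodFunctional_wernerTensor (unit_mem_dualStateSet hF) (unit_mem_dualStateSet hF),
    hF.unit_left, mul_zero, add_zero]

omit [TopologicalSpace G] in
theorem Es_wernerTensor (hF : IsWernerFrame A ζ uS E Es) (φ : ℝ) :
    Es (wernerTensor uS E φ) = φ * ((finrank ℝ V : ℝ) - 1) := by
  simp [wernerTensor, hF.Es_left, hF.Es_E]

/-- The distinguishability norm of Werner tensors for a cone of functionals that has extremal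
points on the span of `U` and `E_*`. -/
theorem distNorm_werner (hA : IsCompletelySymmetric A ζ) (hF : IsWernerFrame A ζ uS E Es)
    (hAB : IsComposite A AB) {M : Set AB.Measurement} {K : PointedCone ℝ (Dual ℝ (V ⊗[ℝ] V))}
    (hM : ∀ μ, μ ∈ M ↔ ∀ i, μ.effect i ∈ K) (hK : K ≤ AB.dualCone) {p m : ℝ} (hp : 0 < p)
    (hm : 0 < m) (h₁ : ∀ F ∈ K, 0 ≤ F (wernerTensor uS E p))
    (h₂ : ∀ F ∈ K, 0 ≤ F (wernerTensor uS E (-m)))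
    (he₁ : prodFunctional A.unit A.unit + (1 / (((finrank ℝ V : ℝ) - 1) * m)) • Es ∈ K)
    (he₂ : prodFunctional A.unit A.unit + (-(1 / (((finrank ℝ V : ℝ) - 1) * p))) • Es ∈ K)
    (a b : ℝ) :
    AB.distNorm M (a • (uS ⊗ₜ[ℝ] uS) + b • E) = planeNorm p m a b := by
  have hd := finrank_sub_one_pos hA
  have hpm : 0 < p + m := by positivity
  rw [eq_combination_wernerTensor hpm.ne', planeNorm]
  -- The weights m/(p+m) and p/(p+m) make the E_* terms cancel and the two functionals sum to U.
  have k₁ := K.smul_mem (div_nonneg hm.le hpm.le) he₁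
  have k₂ := K.smul_mem (div_nonneg hp.le hpm.le) he₂
  refine GPT.distNorm_eq_of_vertices hM hK h₁ h₂ k₁ k₂ ?_ ?_ ?_ ?_ ?_ _ _
  · rw [hAB.unit_eq]
    have h1 : m / (p + m) + p / (p + m) = 1 := by
      field_simp
      ring
    have h2 : m / (p + m) * (1 / (((finrank ℝ V : ℝ) - 1) * m)) +
        p / (p + m) * -(1 / (((finrank ℝ V : ℝ) - 1) * p)) = 0 := by
      field_simp
      ring
    calc _ = (m / (p + m) + p / (p + m)) • prodFunctional A.unit A.unit +
          (m / (p + m) * (1 / (((finrank ℝ V : ℝ) - 1) * m)) +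
            p / (p + m) * -(1 / (((finrank ℝ V : ℝ) - 1) * p))) • Es := by module
      _ = _ := by rw [h1, h2, one_smul, zero_smul, add_zero]
  all_goals
    simp only [LinearMap.smul_apply, LinearMap.add_apply, unit_wernerTensor hF,
      Es_wernerTensor hF, smul_eq_mul]
    field_simp
    try ring

end WernerNorms

/-! ### The parameters `k` -/

section KParameters

variable {V : Type*} [AddCommGroup V] [Module ℝ V] [FiniteDimensional ℝ V]
variable {G : Type*} [Group G] [TopologicalSpace G] {A : GPT V} {ζ : Representation ℝ G V}
variable {uS : V} {E : V ⊗[ℝ] V} {Es : Dual ℝ (V ⊗[ℝ] V)} {AB : GPT (V ⊗[ℝ] V)}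

/-- The tensors χ_φ form a line in the hyperplane U = 1, which meets the cone in a compact set; E ≠
0 because E_*(E) = d - 1. -/
theorem exists_isGreatest_kSet (hA : IsCompletelySymmetric A ζ)
    (hF : IsWernerFrame A ζ uS E Es) (hAB : IsComposite A AB) (huS : uS ∈ A.cone) {s : ℝ}
    (hs : s ≠ 0) : ∃ k, IsGreatest (kSet AB uS E s) k := by
  have hE : s • E ≠ 0 := by
    intro h
    have h0 : E = 0 := (smul_eq_zero.1 h).resolve_left hs
    have h1 := hF.Es_E
    rw [h0, map_zero] at h1
    exact (finrank_sub_one_pos hA).ne h1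
  have heq : kSet AB uS E s =
      {k | uS ⊗ₜ[ℝ] uS + k • s • E ∈ {x | x ∈ AB.cone ∧ AB.unit x = 1}} := by
    ext k
    have h1 : uS ⊗ₜ[ℝ] uS + k • s • E = wernerTensor uS E (s * k) := by
      rw [wernerTensor, smul_smul, mul_comm]
    have h2 : AB.unit (wernerTensor uS E (s * k)) = 1 := by
      rw [hAB.unit_eq, unit_wernerTensor hF]
    change _ ↔ uS ⊗ₜ[ℝ] uS + k • s • E ∈ AB.cone ∧ AB.unit (uS ⊗ₜ[ℝ] uS + k • s • E) = 1
    rw [h1, h2]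
    simp [kSet]
  have h0 : (0 : ℝ) ∈ kSet AB uS E s := by
    change wernerTensor uS E (s * 0) ∈ AB.cone
    rw [wernerTensor, mul_zero, zero_smul, add_zero]
    exact hAB.min_le (PointedCone.tmul_mem_minTensorProduct huS huS)
  rw [heq] at h0 ⊢
  exact exists_isGreatest_line AB.isCompact_states hE ⟨0, h0⟩

/-- The sections of the cone by Werner tensors bound `E_*` on the whole cone. -/
theorem mul_Es_le (hA : IsCompletelySymmetric A ζ) (hAB : IsComposite A AB)
    (hproj : ∀ X ∈ AB.cone, wernerProj A uS E Es X ∈ AB.cone) {s k : ℝ} (hs : s * s = 1)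
    (hk : IsGreatest (kSet AB uS E s) k) {X : V ⊗[ℝ] V} (hX : X ∈ AB.cone) :
    s * Es X ≤ ((finrank ℝ V : ℝ) - 1) * k * AB.unit X := by
  have hd := finrank_sub_one_pos hA
  rcases eq_or_ne X 0 with rfl | hX0
  · simp
  have hU := AB.unit_pos hX hX0
  have h := AB.smul_mem_cone (inv_nonneg.2 hU.le) (hproj X hX)
  have e : (AB.unit X)⁻¹ • wernerProj A uS E Es X =
      wernerTensor uS E (s * (s * Es X / (((finrank ℝ V : ℝ) - 1) * AB.unit X))) := by
    have h2 : s * (s * Es X / (((finrank ℝ V : ℝ) - 1) * AB.unit X)) =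
        (AB.unit X)⁻¹ * (Es X / ((finrank ℝ V : ℝ) - 1)) := by
      rw [← mul_div_assoc, ← mul_assoc, hs, one_mul]
      field_simp
    rw [h2, wernerProj, ← hAB.unit_eq, wernerTensor, smul_add, inv_smul_smul₀ hU.ne', smul_smul]
  rw [e] at h
  have := hk.2 h
  rw [div_le_iff₀ (by positivity)] at this
  linarith

/-- Duality in the plane: `mul_Es_le` gives membership, and evaluation on the opposite extremal
Werner tensor gives optimality. Hence `kSet` carries the sign `-s`. -/
theorem isGreatest_kStarSet (hA : IsCompletelySymmetric A ζ)
    (hF : IsWernerFrame A ζ uS E Es) (hAB : IsComposite A AB)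
    (hproj : ∀ X ∈ AB.cone, wernerProj A uS E Es X ∈ AB.cone) {s k : ℝ} (hs : s * s = 1)
    (hk : IsGreatest (kSet AB uS E (-s)) k) (hk0 : 0 < k) :
    IsGreatest (kStarSet AB Es s) (1 / (((finrank ℝ V : ℝ) - 1) * k)) := by
  have hd := finrank_sub_one_pos hA
  constructor
  · intro X hX
    have h := mul_Es_le hA hAB hproj (by linarith) hk hX
    change 0 ≤ (AB.unit + (s * (1 / (((finrank ℝ V : ℝ) - 1) * k))) • Es) X
    simp only [LinearMap.add_apply, LinearMap.smul_apply, smul_eq_mul]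
    field_simp
    linarith
  · intro c hc
    have h : 0 ≤ (AB.unit + (s * c) • Es) (wernerTensor uS E (-s * k)) := hc hk.1
    rw [LinearMap.add_apply, LinearMap.smul_apply, hAB.unit_eq, unit_wernerTensor hF,
      Es_wernerTensor hF, smul_eq_mul] at h
    have e : s * c * (-s * k * ((finrank ℝ V : ℝ) - 1)) =
        -(s * s) * (c * (((finrank ℝ V : ℝ) - 1) * k)) := by ring
    rw [e, hs] at h
    rw [le_div_iff₀ (by positivity)]
    linarith

end KParameters

/-! ### Werner states -/

section WernerStates

variable {V : Type*} [AddCommGroup V] [Module ℝ V] [FiniteDimensional ℝ V]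
variable {G : Type*} [Group G] {A : GPT V} {ζ : Representation ℝ G V}
variable {uS : V} {E : V ⊗[ℝ] V} {Es : Dual ℝ (V ⊗[ℝ] V)} {AB : GPT (V ⊗[ℝ] V)}

omit [FiniteDimensional ℝ V] in
theorem map_wernerTensor (hF : IsWernerFrame A ζ uS E Es) (φ : ℝ) (g : G) :
    TensorProduct.map (ζ g) (ζ g) (wernerTensor uS E φ) = wernerTensor uS E φ := by
  simp [wernerTensor, hF.invariant_uS, hF.invariant_E]

/-- φ ≠ 0 is what makes the map V* → V bijective. -/
theorem isWernerState_wernerTensor (hF : IsWernerFrame A ζ uS E Es) (hAB : IsComposite A AB)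
    {φ : ℝ} (hφ : φ ≠ 0) (hmem : wernerTensor uS E φ ∈ AB.cone) :
    IsWernerState AB ζ (wernerTensor uS E φ) where
  mem_cone := hmem
  normalised := by rw [hAB.unit_eq, unit_wernerTensor hF]
  symm := by simp [wernerTensor, hF.symm_E]
  bijective := by
    have h := bijective_tensorHom_add hF.unit_uS hF.unit_right hF.pos_E one_ne_zero hφ
    have e : tensorMap (wernerTensor uS E φ) =
        ⇑(φ • tensorHom E + (1 : ℝ) • (Dual.eval ℝ V uS).smulRight uS) := by
      ext f
      simp [wernerTensor, tensorMap_add_left, tensorMap_smul_left, tensorMap_tmul,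
        tensorHom_apply, add_comm]
    rwa [e]
  equivariant g f := by
    rw [← tensorMap_equivariant (map_wernerTensor hF φ g) (f ∘ₗ ζ g⁻¹)]
    congr 2
    ext x
    simp [← Module.End.mul_apply, ← map_mul]

theorem IsWernerState.map_eq {ω : V ⊗[ℝ] V} (hω : IsWernerState AB ζ ω) (g : G) :
    TensorProduct.map (ζ g) (ζ g) ω = ω := by
  refine tensor_ext fun f h => ?_
  rw [← apply_tensorMap, ← apply_tensorMap, tensorMap_map, ← hω.equivariant]
  congr 2
  ext x
  simp [← Module.End.mul_apply, ← map_mul]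

theorem IsWernerState.eq_wernerTensor [TopologicalSpace G] (hA : IsCompletelySymmetric A ζ)
    (hF : IsWernerFrame A ζ uS E Es) (hAB : IsComposite A AB) {ω : V ⊗[ℝ] V}
    (hω : IsWernerState AB ζ ω) : ∃ φ, ω = wernerTensor uS E φ := by
  have h := eq_of_invariant_of_symm hA hF hω.map_eq hω.symm
  rw [← hAB.unit_eq, hω.normalised, one_smul] at h
  exact ⟨_, h⟩

end WernerStates

/-! ### Efficiency of data hiding -/

section Efficiency

variable {V : Type*} [AddCommGroup V] [Module ℝ V] [FiniteDimensional ℝ V]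
variable {G : Type*} [Group G] {A : GPT V} {ζ : Representation ℝ G V}
variable {uS : V} {E : V ⊗[ℝ] V} {Es : Dual ℝ (V ⊗[ℝ] V)} {AB : GPT (V ⊗[ℝ] V)}
variable {p m p' m' : ℝ}

theorem errorProb_eq_iff {W : Type*} [AddCommGroup W] [Module ℝ W] {B : GPT W}
    {M : Set B.Measurement} {ρ σ : W} {q c : ℝ} :
    B.errorProb M ρ σ q = 1 / 2 * (1 - c) ↔ B.distNorm M (q • ρ - (1 - q) • σ) = c := by
  rw [GPT.errorProb]
  constructor <;> intro h <;> linarith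

omit [FiniteDimensional ℝ V] in
-- The maximum is reached at whichever vertex (1, p') or (1, -m') of the SEP ball has the larger
-- base norm.
theorem isGreatest_wernerRatios (hp : 0 < p) (hm : 0 < m) (hpp : p ≤ p') (hmm : m ≤ m')
    (hbase : ∀ a b : ℝ, AB.baseNorm (a • (uS ⊗ₜ[ℝ] uS) + b • E) = planeNorm p m a b)
    (hsep : ∀ a b : ℝ, AB.distNorm (SEP A AB) (a • (uS ⊗ₜ[ℝ] uS) + b • E) =
      planeNorm p' m' a b) :
    IsGreatest (wernerRatios A AB uS E) (1 + 2 / (p + m) * max (m' - m) (p' - p)) := by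
  have hp' := hp.trans_le hpp
  have hm' := hm.trans_le hmm
  constructor
  · rcases le_total (m' - m) (p' - p) with h | h
    · refine ⟨1, p', by simp, ?_⟩
      rw [hbase, hsep, planeNorm_upper hp hm hpp, planeNorm_upper hp' hm' le_rfl, max_eq_right h]
      simp
    · refine ⟨1, -m', by simp, ?_⟩
      rw [hbase, hsep, planeNorm_lower hp hm hmm, planeNorm_lower hp' hm' le_rfl, max_eq_left h]
      simp
  · rintro _ ⟨a, b, hab, rfl⟩
    rw [hbase, hsep, div_le_iff₀ (planeNorm_pos hp' hm' hab)]
    exact planeNorm_le hp hm hpp hmm a b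

omit [FiniteDimensional ℝ V] in
/-- Two Werner states and a priori probabilities that realise a given Werner tensor up to a
scalar. -/
theorem mem_wernerEfficiencies (hR : 1 ≤ planeNorm p m 1 φ)
    (hbase : ∀ a b : ℝ, AB.baseNorm (a • (uS ⊗ₜ[ℝ] uS) + b • E) = planeNorm p m a b)
    (hsep : ∀ a b : ℝ, AB.distNorm (SEP A AB) (a • (uS ⊗ₜ[ℝ] uS) + b • E) =
      planeNorm p' m' a b) (hφ : planeNorm p' m' 1 φ = 1) {ρ σ : V ⊗[ℝ] V}
    (hρ : IsWernerState AB ζ ρ) (hσ : IsWernerState AB ζ σ) {s t : ℝ} (hs : 0 ≤ s) (ht : t ≤ 0)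
    (hst : s - t = planeNorm p m 1 φ) (h : wernerTensor uS E φ = s • ρ + t • σ) :
    planeNorm p m 1 φ ∈ wernerEfficiencies A AB ζ := by
  set R := planeNorm p m 1 φ with hRdef
  have hR0 : 0 < R := one_pos.trans_le hR
  -- Dividing by R makes the base norm 1; the priors are then s/R and -t/R.
  have hX : (s / R) • ρ - (1 - s / R) • σ =
      (R⁻¹ * 1) • (uS ⊗ₜ[ℝ] uS) + (R⁻¹ * φ) • E := by
    have h1 : 1 - s / R = -(R⁻¹ * t) := by
      field_simp
      linarith
    rw [h1, mul_smul, mul_smul, ← smul_add, one_smul]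
    change _ = R⁻¹ • wernerTensor uS E φ
    rw [h, div_eq_inv_mul]
    module
  refine ⟨hR, ρ, σ, hρ, hσ, s / R, ⟨by positivity, ?_⟩, ?_, ?_⟩
  · rw [div_le_one hR0]
    linarith
  · have : AB.errorProb Set.univ ρ σ (s / R) = 1 / 2 * (1 - 1) := by
      rw [errorProb_eq_iff, GPT.distNorm_univ, hX, hbase, planeNorm_smul (by positivity),
        ← hRdef, inv_mul_cancel₀ hR0.ne']
    simpa using this
  · rw [errorProb_eq_iff, hX, hsep, planeNorm_smul (by positivity), hφ, mul_one, one_div]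

/-- A vertex of the SEP ball lies outside the segment between χ_p and χ_{-m}, or at its end, so its
coordinates have opposite signs and give a weighted difference of two Werner states; the roles of ρ
and σ depend on the vertex. -/
theorem isGreatest_wernerEfficiencies [TopologicalSpace G] (hA : IsCompletelySymmetric A ζ)
    (hF : IsWernerFrame A ζ uS E Es) (hAB : IsComposite A AB) (hp : 0 < p) (hm : 0 < m)
    (hpp : p ≤ p') (hmm : m ≤ m') (hpc : wernerTensor uS E p ∈ AB.cone)
    (hmc : wernerTensor uS E (-m) ∈ AB.cone)
    (hbase : ∀ a b : ℝ, AB.baseNorm (a • (uS ⊗ₜ[ℝ] uS) + b • E) = planeNorm p m a b)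
    (hsep : ∀ a b : ℝ, AB.distNorm (SEP A AB) (a • (uS ⊗ₜ[ℝ] uS) + b • E) =
      planeNorm p' m' a b) :
    IsGreatest (wernerEfficiencies A AB ζ) (1 + 2 / (p + m) * max (m' - m) (p' - p)) := by
  have hp' := hp.trans_le hpp
  have hm' := hm.trans_le hmm
  have hpm : 0 < p + m := by positivity
  constructor
  · have hρ := isWernerState_wernerTensor hF hAB hp.ne' hpc
    have hσ := isWernerState_wernerTensor hF hAB (neg_ne_zero.2 hm.ne') hmc
    rcases le_total (m' - m) (p' - p) with h | h
    · rw [max_eq_right h, ← planeNorm_upper hp hm hpp]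
      refine mem_wernerEfficiencies ?_ hbase hsep ?_ hρ hσ
        (s := (1 * m + p') / (p + m)) (t := (1 * p - p') / (p + m)) ?_ ?_ ?_ ?_
      · rw [planeNorm_upper hp hm hpp]
        have : 0 ≤ 2 / (p + m) * (p' - p) := mul_nonneg (by positivity) (sub_nonneg.2 hpp)
        linarith
      · simp [planeNorm_upper hp' hm' le_rfl]
      · positivity
      · exact div_nonpos_of_nonpos_of_nonneg (by linarith) hpm.le
      · rw [planeNorm_upper hp hm hpp]
        field_simp
        ring
      · rw [← eq_combination_wernerTensor hpm.ne', one_smul, wernerTensor]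
    · rw [max_eq_left h, ← planeNorm_lower hp hm hmm]
      refine mem_wernerEfficiencies ?_ hbase hsep ?_ hσ hρ
        (s := (1 * p - -m') / (p + m)) (t := (1 * m + -m') / (p + m)) ?_ ?_ ?_ ?_
      · rw [planeNorm_lower hp hm hmm]
        have : 0 ≤ 2 / (p + m) * (m' - m) := mul_nonneg (by positivity) (sub_nonneg.2 hmm)
        linarith
      · simp [planeNorm_lower hp' hm' le_rfl]
      · exact div_nonneg (by linarith) hpm.le
      · exact div_nonpos_of_nonpos_of_nonneg (by linarith) hpm.le
      · rw [planeNorm_lower hp hm hmm]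
        field_simp
        ring
      · rw [add_comm, ← eq_combination_wernerTensor hpm.ne', one_smul, wernerTensor]
  · rintro R ⟨hR, ρ, σ, hρ, hσ, q, -, h1, h2⟩
    obtain ⟨φ, rfl⟩ := hρ.eq_wernerTensor hA hF hAB
    obtain ⟨ψ, rfl⟩ := hσ.eq_wernerTensor hA hF hAB
    have hX : q • wernerTensor uS E φ - (1 - q) • wernerTensor uS E ψ =
        (q - (1 - q)) • (uS ⊗ₜ[ℝ] uS) + (q * φ - (1 - q) * ψ) • E := by
      simp only [wernerTensor]
      module
    have h1 : AB.errorProb Set.univ (wernerTensor uS E φ) (wernerTensor uS E ψ) q =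
        1 / 2 * (1 - 1) := by
      rw [h1]
      norm_num
    rw [errorProb_eq_iff, hX] at h1 h2
    rw [GPT.distNorm_univ, hbase] at h1
    rw [hsep] at h2
    -- The errors say that the base norm is 1 and the SEP norm is 1/R.
    have h3 := planeNorm_le hp hm hpp hmm (q - (1 - q)) (q * φ - (1 - q) * ψ)
    rw [h1, h2, mul_one_div, le_div_iff₀ (by linarith), one_mul] at h3
    exact h3

end Efficiency

/-! ### The main theorem -/

theorem mainTheorem9 {V : Type*} [AddCommGroup V] [Module ℝ V] [FiniteDimensional ℝ V]
    {G : Type*} [Group G] [TopologicalSpace G] [IsTopologicalGroup G] [CompactSpace G]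
    (A : GPT V) (ζ : Representation ℝ G V) (hA : IsCompletelySymmetric A ζ)
    (AB : GPT (V ⊗[ℝ] V)) (hAB : IsComposite A AB)
    (hsymm : IsSymmetricCone AB ζ)
    (htype : IsRealType A ζ ∨ IsFlipInvariantCone AB) :
    (∃ uS E Es, IsWernerFrame A ζ uS E Es) ∧
    ∀ uS E Es, IsWernerFrame A ζ uS E Es →
      ∃ kp km ksp ksm mp mm msp msm : ℝ,
        -- the parameters are the following maxima
        IsGreatest (kSet AB uS E 1) kp ∧ IsGreatest (kSet AB uS E (-1)) km ∧
        IsGreatest (kStarSet AB Es 1) ksp ∧ IsGreatest (kStarSet AB Es (-1)) ksm ∧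
        IsGreatest (mPlusSet A uS Es) mp ∧ IsGreatest (mMinusSet A uS Es) mm ∧
        IsGreatest (mStarPlusSet A uS E) msp ∧ IsGreatest (mStarMinusSet A uS E) msm ∧
        0 < kp ∧ 0 < km ∧ 0 < msp ∧ 0 < msm ∧
        -- separability of Werner states
        mp / ((finrank ℝ V : ℝ) - 1) ≤ kp ∧ mm / ((finrank ℝ V : ℝ) - 1) ≤ km ∧
        (∀ φ : ℝ, wernerTensor uS E φ ∈ PointedCone.minTensorProduct A.cone A.cone ↔
          -(mm / ((finrank ℝ V : ℝ) - 1)) ≤ φ ∧ φ ≤ mp / ((finrank ℝ V : ℝ) - 1)) ∧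
        -- relations between the parameters
        mm ≤ mp ∧ msm ≤ msp ∧
        ksp * km = 1 / ((finrank ℝ V : ℝ) - 1) ∧ ksm * kp = 1 / ((finrank ℝ V : ℝ) - 1) ∧
        1 ≤ mp * msm ∧ mp * msm ≤ (finrank ℝ V : ℝ) - 1 ∧
        1 ≤ mm * msp ∧ mm * msp ≤ (finrank ℝ V : ℝ) - 1 ∧
        -- the highest efficiency against separable measurements with only Werner states
        IsGreatest (wernerEfficiencies A AB ζ)
          (1 + 2 / (kp + km) * max (1 / msp - km) (1 / msm - kp)) ∧
        IsGreatest (wernerRatios A AB uS E)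
          (1 + 2 / (kp + km) * max (1 / msp - km) (1 / msm - kp)) := by
  refine ⟨exists_wernerFrame hA, fun uS E Es hF => ?_⟩
  have hd := finrank_sub_one_pos hA
  have huS := uS_mem_cone hA hF
  obtain ⟨mp, mm, msp, msm, hmp, hmm, hmsp, hmsm⟩ := exists_m_parameters hA hF
  obtain ⟨kp, hkp⟩ := exists_isGreatest_kSet hA hF hAB huS one_ne_zero
  obtain ⟨km, hkm⟩ := exists_isGreatest_kSet hA hF hAB huS (neg_ne_zero.2 one_ne_zero)
  have hmm0 := mMinus_pos hA hF hmm
  have hle := mMinus_le_mPlus hF hmp hmm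
  have hles := mStarMinus_le_mStarPlus hF hmsp hmsm
  obtain ⟨hg1, hg2⟩ := one_le_mPlus_mul_mStarMinus hA hF hmp hmm hmsp hmsm
  obtain ⟨hl1, hl2⟩ := mPlus_mul_mStarMinus_le hA hF hmp hmm hmsp hmsm
  have hmp0 : 0 < mp := hmm0.trans_le hle
  have hmsm0 : 0 < msm := pos_of_mul_pos_right (one_pos.trans_le hg1) hmp0.le
  have hmsp0 : 0 < msp := hmsm0.trans_le hles
  have hkp1 : mp / ((finrank ℝ V : ℝ) - 1) ≤ kp := hkp.2 <| by
    change wernerTensor uS E (1 * _) ∈ AB.cone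
    rw [one_mul]
    exact hAB.min_le (wernerTensor_mPlus_mem hA hF hmp)
  have hkm1 : mm / ((finrank ℝ V : ℝ) - 1) ≤ km := hkm.2 <| by
    change wernerTensor uS E (-1 * _) ∈ AB.cone
    rw [neg_one_mul]
    exact hAB.min_le (wernerTensor_mMinus_mem hA hF hmm)
  have hkp0 : 0 < kp := (div_pos hmp0 hd).trans_le hkp1
  have hkm0 : 0 < km := (div_pos hmm0 hd).trans_le hkm1
  have hpc : wernerTensor uS E kp ∈ AB.cone := by simpa [kSet] using hkp.1
  have hmc : wernerTensor uS E (-km) ∈ AB.cone := by simpa [kSet] using hkm.1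
  have hproj : ∀ X ∈ AB.cone, wernerProj A uS E Es X ∈ AB.cone := fun X hX =>
    wernerProj_mem hA hF AB.convex_cone AB.closed htype fun g => hsymm g X hX
  have hksp := isGreatest_kStarSet hA hF hAB hproj (s := 1) (by norm_num) hkm hkm0
  have hksm := isGreatest_kStarSet hA hF hAB hproj (s := -1) (by norm_num)
    (by rwa [neg_neg]) hkp0
  -- χ_{k_+} is in the maximal cone, hence nonnegative on the product functional attaining m_-^*:
  -- the SEP ball contains the base norm ball.
  have hpp : kp ≤ 1 / msm := by
    have h := hmsm.1
    rw [mStarMinusSet_eq hF] at h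
    obtain ⟨f, hf, g, hg, hfg⟩ := h
    have := one_add_nonneg_of_mem_max (hAB.le_max hpc) hf hg
    rw [← tensorForm_apply, ← neg_eq_iff_eq_neg.2 hfg] at this
    rw [le_div_iff₀ hmsm0]
    linarith
  have hmm' : km ≤ 1 / msp := by
    have h := hmsp.1
    rw [mStarPlusSet_eq hF] at h
    obtain ⟨f, hf, hff⟩ := h
    have := one_add_nonneg_of_mem_max (hAB.le_max hmc) hf hf
    rw [← tensorForm_apply, ← hff] at this
    rw [le_div_iff₀ hmsp0]
    linarith
  have hbase : ∀ a b : ℝ, AB.baseNorm (a • (uS ⊗ₜ[ℝ] uS) + b • E) = planeNorm kp km a b := by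
    intro a b
    rw [← GPT.distNorm_univ]
    refine distNorm_werner hA hF hAB (K := AB.dualCone)
      (fun μ => ⟨fun _ i => (μ.mem_effects i).1, fun _ => trivial⟩) le_rfl hkp0 hkm0
      (fun F hF => hF hpc) (fun F hF => hF hmc) ?_ ?_ a b
    · have := hksp.1
      rw [kStarSet, Set.mem_ofPred_eq, one_mul, hAB.unit_eq] at this
      exact this
    · have := hksm.1
      rw [kStarSet, Set.mem_ofPred_eq, neg_one_mul, hAB.unit_eq] at this
      exact this
  have hsep : ∀ a b : ℝ, AB.distNorm (SEP A AB) (a • (uS ⊗ₜ[ℝ] uS) + b • E) =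
      planeNorm (1 / msm) (1 / msp) a b := by
    intro a b
    -- The vertices χ_{1/m_-^*} and χ_{-1/m_+^*} need not lie in C_AB; they only have to be
    -- nonnegative on separable functionals.
    refine distNorm_werner hA hF hAB (K := sepCone A) (fun μ => Iff.rfl) ?_ (by positivity)
      (by positivity) (fun F hFs => sep_nonneg_of_dualStates hA hF (fun f hf g hg => ?_) hFs)
      (fun F hFs => sep_nonneg_of_dualStates hA hF (fun f hf g hg => ?_) hFs) ?_ ?_ a b
    · exact fun F hF X hX => sepCone_nonneg
        (fun f hf g hg => PointedCone.mem_maxTensorProduct.1 (hAB.le_max hX) f hf g hg) hF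
    · rw [prodFunctional_wernerTensor hf hg]
      have := neg_mStarMinus_le_form hF hmsm hf hg
      field_simp
      linarith
    · rw [prodFunctional_wernerTensor hf hg]
      have := (abs_le.1 (form_le_mStarPlus hF hmsp hf hg)).2
      field_simp
      linarith
    · have h := hmsp.1
      rw [mStarPlusSet_eq hF] at h
      obtain ⟨f, hf, hff⟩ := h
      have e : 1 / (((finrank ℝ V : ℝ) - 1) * (1 / msp)) =
          prodFunctional f f E / ((finrank ℝ V : ℝ) - 1) := by
        rw [← tensorForm_apply, ← hff]
        field_simp
      rw [e]
      exact unit_add_mem_sepCone hA hF hf hf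
    · have h := hmsm.1
      rw [mStarMinusSet_eq hF] at h
      obtain ⟨f, hf, g, hg, hfg⟩ := h
      have e : -(1 / (((finrank ℝ V : ℝ) - 1) * (1 / msm))) =
          prodFunctional f g E / ((finrank ℝ V : ℝ) - 1) := by
        rw [← tensorForm_apply, ← neg_eq_iff_eq_neg.2 hfg]
        field_simp
      rw [e]
      exact unit_add_mem_sepCone hA hF hf hg
  refine ⟨kp, km, _, _, mp, mm, msp, msm, hkp, hkm, hksp, hksm, hmp, hmm, hmsp, hmsm, hkp0, hkm0,
    hmsp0, hmsm0, hkp1, hkm1, wernerTensor_mem_min_iff hA hF hmp hmm, hle, hles, ?_, ?_, hg1, hl1,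
    hg2, hl2, ?_, ?_⟩
  · field_simp
  · field_simp
  · exact isGreatest_wernerEfficiencies hA hF hAB hkp0 hkm0 hpp hmm' hpc hmc hbase hsep
  · exact isGreatest_wernerRatios hkp0 hkm0 hpp hmm' hbase hsep
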